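/- Consider the plant $\dot x = Ax + B_u u + B_w w$, $z = C_z x + D_u u + D_w w$, $y = C_y x + D_{yw} w$ with real matrices, $x\in\mathbb R^{N_x}$, $u\in\mathbb R^{N_u}$, $y\in\mathbb R^{N_y}$, and a controller $\dot x_K = A_K x_K + B_K y$, $u = C_K x_K + D_K y$, written $J=\begin{bmatrix}A_K&B_K\\C_K&D_K\end{bmatrix}$. The closed loop is $$A_{cl}=\begin{bmatrix}A+B_uD_KC_y & B_uC_K\\ B_KC_y & A_K\end{bmatrix},\quad B_{cl}=\begin{bmatrix}B_w+B_uD_KD_{yw}\\ B_KD_{yw}\end{bmatrix},\quad C_{cl}=\begin{bmatrix}C_z+D_uD_KC_y & D_uC_K\end{bmatrix},\quad D_{cl}=D_w+D_uD_KD_{yw},$$ with transfer function $\mathcal G_{cl}(s)=C_{cl}(sI-A_{cl})^{-1}B_{cl}+D_{cl}$. Let $\gamma_0>0$ and let $\mu\in\mathbb R^{N_u}$, $\nu\in\mathbb R^{N_y}$ be entrywise nonnegative. The controller $J$ meets the specification if $A_{cl}$ is Hurwitz and $\|\mathcal G_{cl}\|_{\mathcal H_2}<\gamma_0$, where $\|\mathcal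 G\|_{\mathcal H_2}^2=\frac1{2\pi}\int_{-\infty}^{\infty}\operatorname{tr}\big(\mathcal G(i\omega)^*\mathcal G(i\omega)\big)\,d\omega\in[0,\infty]$. A symmetric matrix $X_{cl}>0$ is called a Lyapunov matrix of the closed loop for the bound $\gamma_0$ if $P=X_{cl}^{-1}$ satisfies $A_{cl}P+PA_{cl}^\top+B_{cl}B_{cl}^\top<0$ and $\operatorname{tr}(C_{cl}PC_{cl}^\top)<\gamma_0^2$. For a controller of order $N_x$ and a partition $X_{cl}=\begin{bmatrix}Y&N\\N^\top&\star\end{bmatrix}$, $X_{cl}^{-1}=\begin{bmatrix}X&M\\M^\top&\star\end{bmatrix}$ with $M,N$ nonsingular, the transformed variables $\hat J=\begin{bmatrix}\hat A_K&\hat B_K\\\hat C_K&\hat D_K\end{bmatrix}$ are $$\hat A_K=NA_KM^\top+NB_KC_yX+YB_uC_KM^\top+Y(A+B_uD_KC_y)X,\quad \hat B_K=NB_K+YB_uD_K,\quad \hat C_K=C_KM^\top+D_KC_yX,\quad \hat D_K=D_K .$$ Let $\bar c_i^\top$ be the rows of $[\hat C_K\ \hat D_K]$, let $\bar b_j$ be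 the columns of $\begin{bmatrix}\hat B_K\\\hat D_K\end{bmatrix}$, and put $f(\hat J)=\sum_{i=1}^{N_u}\mu_i\|\bar c_i\|_2+\sum_{j=1}^{N_y}\nu_j\|\bar b_j\|_2$. **Design problem.** Minimise $f(\hat J)$ over all $\hat J$ that are the transformed variables of some controller of order $N_x$ meeting the specification, with respect to some Lyapunov matrix of its closed loop for the bound $\gamma_0$ (partitioned as above). **LMI programme.** Minimise $f(\hat J)$ over $(\hat J,X,Y,Q)$ subject to $$\begin{bmatrix} AX+B_u\hat C_K+(AX+B_u\hat C_K)^\top & \ast&\ast\\ \hat A_K+(A+B_u\hat D_KC_y)^\top & YA+\hat B_KC_y+(YA+\hat B_KC_y)^\top&\ast\\ (B_w+B_u\hat D_KD_{yw})^\top&(YB_w+\hat B_KD_{yw})^\top&-I\end{bmatrix}<0,$$ $$\begin{bmatrix}X&I&(C_zX+D_u\hat C_K)^\top\\ \ast&Y&(C_z+D_u\hat D_KC_y)^\top\\ \ast&\ast&Q\end{bmatrix}>0,\qquad \operatorname{tr}Q<\gamma_0^2,\qquad D_w+D_u\hat D_KD_{yw}=0 .$$ **Theorem.** The LMI programme is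 convex and solves the design problem: 1. The two problems have the same feasible $\hat J$, the same optimal value, and the same minimisers $\hat J$. 2. A controller of order $N_x$ meets the specification if and only if, for some symmetric $X_{cl}>0$ partitioned as above (with $M,N$ nonsingular) and some $Q$, its transformed variables together with $X,Y,Q$ satisfy the LMI constraints. 3. If $(\hat J,X,Y,Q)$ satisfies the LMI constraints, then $I-XY$ is nonsingular, and for all square $M,N$ with $MN^\top=I-XY$ the controller $D_K=\hat D_K$, $C_K=(\hat C_K-D_KC_yX)M^{-\top}$, $B_K=N^{-1}(\hat B_K-YB_uD_K)$, $A_K=N^{-1}\big(\hat A_K-NB_KC_yX-YB_uC_KM^\top-Y(A+B_uD_KC_y)X\big)M^{-\top}$ meets the specification, and $X,Y,M,N$ are the blocks of a Lyapunov matrix of its closed loop for the bound $\gamma_0$, with respect to which its transformed variables are $\hat J$. 4. If a controller of any order meets the specification, the LMI constraints are feasible. -/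

import Mathlib

open Matrix MeasureTheory

noncomputable section

namespace SparseH2

/-- `sym M = M + Mᵀ`. -/
def sym {n : Type*} (M : Matrix n n ℝ) : Matrix n n ℝ := M + Mᵀ

/-- A real square matrix is Hurwitz if all its complex eigenvalues have negative real part. -/
def IsHurwitz {n : Type*} [Fintype n] [DecidableEq n] (A : Matrix n n ℝ) : Prop :=
  ∀ s ∈ spectrum ℂ (A.map Complex.ofReal), s.re < 0

/-- The transfer function `G(s) = C (s I - A)⁻¹ B + D`. -/
def transferFun {n w z : Type*} [Fintype n] [DecidableEq n]
    (A : Matrix n n ℝ) (B : Matrix n w ℝ) (C : Matrix z n ℝ) (D : Matrix z w ℝ) (s : ℂ) :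
    Matrix z w ℂ :=
  C.map Complex.ofReal * (s • (1 : Matrix n n ℂ) - A.map Complex.ofReal)⁻¹ * B.map Complex.ofReal
    + D.map Complex.ofReal

/-- The `H₂` norm `((1 / 2π) ∫ tr (G(iω)ᴴ G(iω)) dω) ^ (1/2)` of a stable transfer function,
with values in `[0, ∞]` (it is infinite if `G` does not vanish at infinity). It is only used
together with stability of the realization of `G`. -/
def h2Norm {w z : Type*} [Fintype w] [Fintype z] (G : ℂ → Matrix z w ℂ) : ENNReal :=
  (ENNReal.ofReal (1 / (2 * Real.pi)) *
    ∫⁻ ω : ℝ, ENNReal.ofReal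
      (((G (Complex.I * (ω : ℂ)))ᴴ * G (Complex.I * (ω : ℂ))).trace.re)) ^ (1 / 2 : ℝ)

/-- The data of the plant
`x' = A x + Bu u + Bw w`, `z = Cz x + Du u + Dw w`, `y = Cy x + Dyw w`. -/
structure Plant (x u w z y : Type*) where
  A : Matrix x x ℝ
  Bu : Matrix x u ℝ
  Bw : Matrix x w ℝ
  Cz : Matrix z x ℝ
  Du : Matrix z u ℝ
  Dw : Matrix z w ℝ
  Cy : Matrix y x ℝ
  Dyw : Matrix y w ℝ

/-- A controller `xK' = AK xK + BK y`, `u = CK xK + DK y` with state index `k` (its order is the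
cardinality of `k`), written as the block matrix `[AK BK; CK DK]`. -/
abbrev Controller (k u y : Type*) := Matrix (k ⊕ u) (k ⊕ y) ℝ

variable {x u w z y k : Type*} [Fintype x] [Fintype u] [Fintype w] [Fintype z] [Fintype y]
  [Fintype k] [DecidableEq x] [DecidableEq w] [DecidableEq k]

/-- Closed-loop state matrix. -/
def Acl (S : Plant x u w z y) (J : Controller k u y) : Matrix (x ⊕ k) (x ⊕ k) ℝ :=
  fromBlocks (S.A + S.Bu * J.toBlocks₂₂ * S.Cy) (S.Bu * J.toBlocks₂₁)
    (J.toBlocks₁₂ * S.Cy) J.toBlocks₁₁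

/-- Closed-loop disturbance input matrix. -/
def Bcl (S : Plant x u w z y) (J : Controller k u y) : Matrix (x ⊕ k) w ℝ :=
  fromRows (S.Bw + S.Bu * J.toBlocks₂₂ * S.Dyw) (J.toBlocks₁₂ * S.Dyw)

/-- Closed-loop output matrix. -/
def Ccl (S : Plant x u w z y) (J : Controller k u y) : Matrix z (x ⊕ k) ℝ :=
  fromCols (S.Cz + S.Du * J.toBlocks₂₂ * S.Cy) (S.Du * J.toBlocks₂₁)

/-- Closed-loop feedthrough matrix. -/
def Dcl (S : Plant x u w z y) (J : Controller k u y) : Matrix z w ℝ :=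
  S.Dw + S.Du * J.toBlocks₂₂ * S.Dyw

/-- Closed-loop transfer function from `w` to `z`. -/
def Gcl (S : Plant x u w z y) (J : Controller k u y) : ℂ → Matrix z w ℂ :=
  transferFun (Acl S J) (Bcl S J) (Ccl S J) (Dcl S J)

/-- The design specification: the closed loop is internally stable and `‖G_cl‖_{H₂} < γ₀`. -/
def MeetsH2Spec (S : Plant x u w z y) (γ₀ : ℝ) (J : Controller k u y) : Prop :=
  IsHurwitz (Acl S J) ∧ h2Norm (Gcl S J) < ENNReal.ofReal γ₀

/-- `X_cl` is a Lyapunov matrix of the closed loop for the `H₂` bound `γ₀`: it is positive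
definite, and `P = X_cl⁻¹` satisfies the strict Lyapunov inequality
`A_cl P + P A_clᵀ + B_cl B_clᵀ < 0` with `tr (C_cl P C_clᵀ) < γ₀²`. -/
def IsH2LyapunovMatrix (S : Plant x u w z y) (γ₀ : ℝ) (J : Controller k u y)
    (Xcl : Matrix (x ⊕ k) (x ⊕ k) ℝ) : Prop :=
  Xcl.PosDef ∧
  (-(Acl S J * Xcl⁻¹ + Xcl⁻¹ * (Acl S J)ᵀ + Bcl S J * (Bcl S J)ᵀ)).PosDef ∧
  (Ccl S J * Xcl⁻¹ * (Ccl S J)ᵀ).trace < γ₀ ^ 2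

/-- `X_cl = [Y N; Nᵀ ⋆]` and `X_cl⁻¹ = [X M; Mᵀ ⋆]`. -/
def IsPartition (Xcl : Matrix (x ⊕ k) (x ⊕ k) ℝ) (X Y : Matrix x x ℝ) (M N : Matrix x k ℝ) :
    Prop :=
  Xcl.toBlocks₁₁ = Y ∧ Xcl.toBlocks₁₂ = N ∧ Xcl.toBlocks₂₁ = Nᵀ ∧
  Xcl⁻¹.toBlocks₁₁ = X ∧ Xcl⁻¹.toBlocks₁₂ = M ∧ Xcl⁻¹.toBlocks₂₁ = Mᵀ

/-- The change of controller variables `J ↦ Ĵ = [Â_K B̂_K; Ĉ_K D̂_K]`. -/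
def hat (S : Plant x u w z y) (J : Controller k u y) (X Y : Matrix x x ℝ) (M N : Matrix x k ℝ) :
    Matrix (x ⊕ u) (x ⊕ y) ℝ :=
  fromBlocks
    (N * J.toBlocks₁₁ * Mᵀ + N * J.toBlocks₁₂ * S.Cy * X + Y * S.Bu * J.toBlocks₂₁ * Mᵀ
      + Y * (S.A + S.Bu * J.toBlocks₂₂ * S.Cy) * X)
    (N * J.toBlocks₁₂ + Y * S.Bu * J.toBlocks₂₂)
    (J.toBlocks₂₁ * Mᵀ + J.toBlocks₂₂ * S.Cy * X)
    J.toBlocks₂₂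

/-- The controller constructed from `Ĵ`, `X`, `Y` and nonsingular `M`, `N`. -/
def construct (S : Plant x u w z y) (Jh : Matrix (x ⊕ u) (x ⊕ y) ℝ) (X Y M N : Matrix x x ℝ) :
    Controller x u y :=
  let DK := Jh.toBlocks₂₂
  let CK := (Jh.toBlocks₂₁ - DK * S.Cy * X) * (Mᵀ)⁻¹
  let BK := N⁻¹ * (Jh.toBlocks₁₂ - Y * S.Bu * DK)
  let AK := N⁻¹ * (Jh.toBlocks₁₁ - N * BK * S.Cy * X - Y * S.Bu * CK * Mᵀ
    - Y * (S.A + S.Bu * DK * S.Cy) * X) * (Mᵀ)⁻¹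
  fromBlocks AK BK CK DK

/-- `Ĵ` is the vector of transformed variables of the full-order controller `J`, which meets the
specification, with respect to the blocks `X, Y, M, N` (`M, N` nonsingular) of a Lyapunov matrix
of the closed loop for the `H₂` bound. -/
def Represents (S : Plant x u w z y) (γ₀ : ℝ) (J : Controller x u y) (X Y M N : Matrix x x ℝ)
    (Jh : Matrix (x ⊕ u) (x ⊕ y) ℝ) : Prop :=
  MeetsH2Spec S γ₀ J ∧
  (∃ Xcl, IsH2LyapunovMatrix S γ₀ J Xcl ∧ IsPartition Xcl X Y M N) ∧
  IsUnit M ∧ IsUnit N ∧ Jh = hat S J X Y M N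

/-- Feasible set of the sparse sensing and actuation design problem (the minimization over `Ĵ`
subject to `‖G_cl‖_{H₂} < γ₀`). -/
def designFeasible (S : Plant x u w z y) (γ₀ : ℝ) : Set (Matrix (x ⊕ u) (x ⊕ y) ℝ) :=
  {Jh | ∃ (J : Controller x u y) (X Y M N : Matrix x x ℝ), Represents S γ₀ J X Y M N Jh}

/-- Weighted sum of the 2-norms of the rows of `[Ĉ_K D̂_K]` and of the columns of `[B̂_K; D̂_K]`. -/
def cost (μ : u → ℝ) (ν : y → ℝ) (Jh : Matrix (x ⊕ u) (x ⊕ y) ℝ) : ℝ :=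
  ∑ i, μ i * ‖WithLp.toLp 2 (fun c => fromCols Jh.toBlocks₂₁ Jh.toBlocks₂₂ i c)‖
    + ∑ j, ν j * ‖WithLp.toLp 2 (fun r => fromRows Jh.toBlocks₁₂ Jh.toBlocks₂₂ r j)‖

/-- The left-hand side of the first matrix inequality. -/
def lmi₁ (S : Plant x u w z y) (Jh : Matrix (x ⊕ u) (x ⊕ y) ℝ) (X Y : Matrix x x ℝ) :
    Matrix ((x ⊕ x) ⊕ w) ((x ⊕ x) ⊕ w) ℝ :=
  let E := Jh.toBlocks₁₁ + (S.A + S.Bu * Jh.toBlocks₂₂ * S.Cy)ᵀ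
  let F₁ := S.Bw + S.Bu * Jh.toBlocks₂₂ * S.Dyw
  let F₂ := Y * S.Bw + Jh.toBlocks₁₂ * S.Dyw
  fromBlocks
    (fromBlocks (sym (S.A * X + S.Bu * Jh.toBlocks₂₁)) Eᵀ E (sym (Y * S.A + Jh.toBlocks₁₂ * S.Cy)))
    (fromRows F₁ F₂)
    (fromCols F₁ᵀ F₂ᵀ)
    (-1)

/-- The left-hand side of the second matrix inequality. -/
def lmi₂ (S : Plant x u w z y) (Jh : Matrix (x ⊕ u) (x ⊕ y) ℝ) (X Y : Matrix x x ℝ)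
    (Q : Matrix z z ℝ) : Matrix ((x ⊕ x) ⊕ z) ((x ⊕ x) ⊕ z) ℝ :=
  let H₁ := S.Cz * X + S.Du * Jh.toBlocks₂₁
  let H₂ := S.Cz + S.Du * Jh.toBlocks₂₂ * S.Cy
  fromBlocks (fromBlocks X 1 1 Y) (fromRows H₁ᵀ H₂ᵀ) (fromCols H₁ H₂) Q

/-- Feasible set of the programme with linear matrix inequalities, in the variables
`(Ĵ, X, Y, Q)`. -/
def lmiFeasible (S : Plant x u w z y) (γ₀ : ℝ) :
    Set (Matrix (x ⊕ u) (x ⊕ y) ℝ × Matrix x x ℝ × Matrix x x ℝ × Matrix z z ℝ) :=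
  {p | (-(lmi₁ S p.1 p.2.1 p.2.2.1)).PosDef ∧ (lmi₂ S p.1 p.2.1 p.2.2.1 p.2.2.2).PosDef ∧
    p.2.2.2.trace < γ₀ ^ 2 ∧ S.Dw + S.Du * p.1.toBlocks₂₂ * S.Dyw = 0}

end SparseH2

end

/-! The proof has an analytic half and an algebraic half.

Analytic half (`stable_h2Norm_lt_iff`): a realization is stable with `H₂` norm below `γ` exactly
when `D = 0` and some `P > 0` satisfies the strict Lyapunov inequality with `tr (C P Cᵀ) < γ²`. The
Gramian is taken directly in the frequency domain, as `∫ R(iω) W R(iω)* dω` with `R` the resolvent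
of `A`. Multiplying by `A` and using `A R = iω R - 1` reduces the Lyapunov equation to the principal
value `∫ R(iω) dω = π`, which follows from Cauchy's theorem by comparison with the resolvent of
`-1`. The norm is then the trace of a Gramian, and strictness comes from adding a small multiple of
the Gramian of `I`.

Algebraic half: with `Π₁ = [X I; Mᵀ 0]` and `Π₂ = [I Y; 0 Nᵀ]`, inverse blocks satisfy `P Π₂ = Π₁`.
Congruence by `Π₂` together with Schur complements turns the certificate into the two matrix
inequalities (`neg_lmi₁_eq`, `lmi₂_eq`), since all products of controller and Lyapunov blocks
collapse into `Ĵ`. Conversely, the second inequality contains `[X I; I Y] > 0`, which makes `I - XY`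
nonsingular and lets `X_cl` and the controller be rebuilt.

Nonsingularity of `M` is arranged by perturbing `P`, which strict inequalities allow. Controllers of
other orders are first padded with stable decoupled states, after which only injectivity of `Mᵀ` is
needed. The cost depends on `Ĵ` alone, so equality of the sets of feasible `Ĵ` gives equality of
values and minimisers. -/

noncomputable section

namespace SparseH2

open Filter Topology Asymptotics Bornology
open scoped ComplexOrder

/-! ### Resolvent integrals along the imaginary axis -/

section Resolvent

/-- Cauchy's theorem on the rectangle `[0, T] × [-T, T]`: the three sides off the imaginary axis
have total length `4T` and lie in `‖s‖ ≥ T`, so they contribute `O(T · T⁻²)`. -/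
theorem tendsto_integral_imaginary_axis_zero {E : Type*} [NormedAddCommGroup E] [NormedSpace ℂ E]
    {f : ℂ → E} (hd : ∀ s : ℂ, 0 ≤ s.re → DifferentiableAt ℂ f s)
    (hO : f =O[cobounded ℂ] fun s => (‖s‖ ^ 2)⁻¹) :
    Tendsto (fun T : ℝ => ∫ ω in (-T)..T, f (Complex.I * (ω : ℂ))) atTop (𝓝 0) := by
  obtain ⟨C, hC⟩ := hO.bound
  rw [atTop_basis_Ioi.cobounded_of_norm.eventually_iff] at hC
  obtain ⟨r, -, hr⟩ := hC
  have hbd : ∀ s : ℂ, ∀ T : ℝ, r < T → 0 < T → T ≤ ‖s‖ → ‖f s‖ ≤ |C| * (T ^ 2)⁻¹ := by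
    intro s T hT hT0 hs
    refine (hr (x := s) (by simpa using hT.trans_le hs)).trans ?_
    rw [Real.norm_of_nonneg (by positivity)]
    gcongr
    exact le_abs_self C
  refine squeeze_zero_norm' (a := fun T : ℝ => 4 * |C| * T⁻¹) ?_ ?_
  · filter_upwards [eventually_gt_atTop r, eventually_gt_atTop 0] with T hT hT0
    have key := Complex.integral_boundary_rect_eq_zero_of_differentiableOn f
      (-(T : ℂ) * Complex.I) (T + T * Complex.I) (fun s hs => by
        refine (hd s ?_).differentiableWithinAt
        have := hs.1
        simp [Set.uIcc_of_le hT0.le] at this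
        exact this.1)
    simp only [Complex.add_re, Complex.neg_re, Complex.mul_re, Complex.ofReal_re, Complex.I_re,
      Complex.ofReal_im, Complex.I_im, Complex.add_im, Complex.neg_im, Complex.mul_im, mul_zero,
      mul_one, neg_zero, add_zero, zero_add, sub_self] at key
    have e : (∫ y in (-T)..T, f (Complex.I * y)) = -Complex.I •
        ((∫ x in (0 : ℝ)..T, f (x + (-T : ℝ) * Complex.I))
          - (∫ x in (0 : ℝ)..T, f (x + T * Complex.I))
          + Complex.I • ∫ y in (-T)..T, f (T + y * Complex.I)) := by
      rw [sub_eq_zero] at key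
      rw [key, smul_smul]
      simp [mul_comm]
    rw [e, norm_smul]
    have h1 : ∀ c : ℝ, |c| = T → ‖∫ x in (0 : ℝ)..T, f (x + c * Complex.I)‖
        ≤ |C| * (T ^ 2)⁻¹ * T := by
      intro c hc
      have := intervalIntegral.norm_integral_le_of_norm_le_const (a := 0) (b := T)
        (f := fun x : ℝ => f (x + c * Complex.I)) (C := |C| * (T ^ 2)⁻¹) (fun x _ => by
          refine hbd _ T hT hT0 ?_
          have := Complex.abs_im_le_norm (x + c * Complex.I)
          simpa [hc] using this)
      simpa [abs_of_pos hT0] using this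
    have h2 : ‖∫ y in (-T)..T, f (T + y * Complex.I)‖ ≤ |C| * (T ^ 2)⁻¹ * (2 * T) := by
      have := intervalIntegral.norm_integral_le_of_norm_le_const (a := -T) (b := T)
        (f := fun x : ℝ => f (T + x * Complex.I)) (C := |C| * (T ^ 2)⁻¹) (fun x _ => by
          refine hbd _ T hT hT0 ?_
          have := Complex.abs_re_le_norm (T + x * Complex.I)
          simpa [abs_of_pos hT0] using this)
      rwa [show T - -T = 2 * T by ring, abs_of_pos (a := 2 * T) (by positivity)] at this
    have h3 := norm_add_le ((∫ x in (0 : ℝ)..T, f (x + (-T : ℝ) * Complex.I))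
          - (∫ x in (0 : ℝ)..T, f (x + T * Complex.I)))
          (Complex.I • ∫ y in (-T)..T, f (T + y * Complex.I))
    have h4 := norm_sub_le (∫ x in (0 : ℝ)..T, f (x + (-T : ℝ) * Complex.I))
          (∫ x in (0 : ℝ)..T, f (x + T * Complex.I))
    rw [norm_smul, Complex.norm_I, one_mul] at h3
    have h5 := h1 (-T) (by simp [abs_of_pos hT0])
    have h6 := h1 T (abs_of_pos hT0)
    have h7 : 4 * |C| * T⁻¹ = 2 * (|C| * (T ^ 2)⁻¹ * T) + |C| * (T ^ 2)⁻¹ * (2 * T) := by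
      field_simp; ring
    simp only [norm_neg, Complex.norm_I, one_mul]
    linarith
  · simpa using (tendsto_inv_atTop_zero (𝕜 := ℝ)).const_mul (4 * |C|)

variable {𝔸 : Type*} [NormedRing 𝔸] [NormedAlgebra ℂ 𝔸]

theorem resolvent_sub_resolvent {a b : 𝔸} {s : ℂ} (ha : s ∈ resolventSet ℂ a)
    (hb : s ∈ resolventSet ℂ b) :
    resolvent a s - resolvent b s = resolvent a s * (a - b) * resolvent b s := by
  have h1 : resolvent a s * (algebraMap ℂ 𝔸 s - a) = 1 := Ring.inverse_mul_cancel _ ha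
  have h2 : (algebraMap ℂ 𝔸 s - b) * resolvent b s = 1 := Ring.mul_inverse_cancel _ hb
  calc resolvent a s - resolvent b s
      = resolvent a s * ((algebraMap ℂ 𝔸 s - b) * resolvent b s)
        - (resolvent a s * (algebraMap ℂ 𝔸 s - a)) * resolvent b s := by simp [h1, h2]
    _ = _ := by noncomm_ring

variable [CompleteSpace 𝔸]

omit [CompleteSpace 𝔸] in
theorem mem_resolventSet_of_stable {a : 𝔸} (ha : ∀ s ∈ spectrum ℂ a, s.re < 0) {s : ℂ}
    (hs : 0 ≤ s.re) : s ∈ resolventSet ℂ a := by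
  by_contra h
  exact absurd (ha s h) (not_lt.mpr hs)

theorem resolvent_mul_resolvent_isBigO (a b w : 𝔸) :
    (fun s => resolvent a s * w * resolvent b s) =O[cobounded ℂ] fun s => (‖s‖ ^ 2)⁻¹ := by
  have h1 : resolvent a =O[cobounded ℂ] fun s => ‖s‖⁻¹ := by
    exact (spectrum.resolvent_isBigO_inv (𝕜 := ℂ) a).norm_right.congr_right fun s => norm_inv s
  have h2 : resolvent b =O[cobounded ℂ] fun s => ‖s‖⁻¹ := by
    exact (spectrum.resolvent_isBigO_inv (𝕜 := ℂ) b).norm_right.congr_right fun s => norm_inv s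
  refine ((h1.mul (isBigO_const_const w (one_ne_zero (α := ℝ)) _)).mul h2).congr_right fun s => ?_
  rw [mul_one, sq, mul_inv]

/-- Each resolvent decays only like `1 / ‖s‖`, but by the resolvent identity the difference is a
product of two of them and decays quadratically. -/
theorem tendsto_integral_resolvent_sub {a b : 𝔸} (ha : ∀ s ∈ spectrum ℂ a, s.re < 0)
    (hb : ∀ s ∈ spectrum ℂ b, s.re < 0) :
    Tendsto (fun T : ℝ => ∫ ω in (-T)..T,
      (resolvent a (Complex.I * (ω : ℂ)) - resolvent b (Complex.I * (ω : ℂ)))) atTop (𝓝 0) := by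
  refine tendsto_integral_imaginary_axis_zero (f := fun s => resolvent a s - resolvent b s) ?_ ?_
  · intro s hs
    exact (spectrum.hasDerivAt_resolvent_const_left (mem_resolventSet_of_stable ha
      hs)).differentiableAt.sub (spectrum.hasDerivAt_resolvent_const_left (mem_resolventSet_of_stable hb hs)).differentiableAt
  · refine (resolvent_mul_resolvent_isBigO a b (a - b)).congr' ?_ EventuallyEq.rfl
    have hu := spectrum.eventually_isUnit_resolvent (𝕜 := ℂ) a
    have hv := spectrum.eventually_isUnit_resolvent (𝕜 := ℂ) b
    filter_upwards [hu, hv] with s h1 h2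
    exact (resolvent_sub_resolvent (spectrum.isUnit_resolvent.mpr h1)
      (spectrum.isUnit_resolvent.mpr h2)).symm

theorem continuous_resolvent_imaginary_axis {a : 𝔸} (ha : ∀ s ∈ spectrum ℂ a, s.re < 0) :
    Continuous fun ω : ℝ => resolvent a (Complex.I * (ω : ℂ)) := by
  rw [continuous_iff_continuousAt]
  intro ω
  have h := (spectrum.hasDerivAt_resolvent_const_left (mem_resolventSet_of_stable ha
    (s := Complex.I * (ω : ℂ)) (by simp))).continuousAt
  exact ContinuousAt.comp (f := fun ω : ℝ => Complex.I * (ω : ℂ)) h (by fun_prop)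

omit [CompleteSpace 𝔸] in
theorem resolvent_neg_one {s : ℂ} (hs : s + 1 ≠ 0) :
    resolvent (-1 : 𝔸) s = (s + 1)⁻¹ • (1 : 𝔸) := by
  have e : algebraMap ℂ 𝔸 s - -1 = algebraMap ℂ 𝔸 (s + 1) := by simp
  have h1 : algebraMap ℂ 𝔸 (s + 1) * algebraMap ℂ 𝔸 ((s + 1)⁻¹) = 1 := by
    rw [← map_mul, mul_inv_cancel₀ hs, map_one]
  have h2 : algebraMap ℂ 𝔸 ((s + 1)⁻¹) * algebraMap ℂ 𝔸 (s + 1) = 1 := by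
    rw [← map_mul, inv_mul_cancel₀ hs, map_one]
  rw [resolvent, e, ← Algebra.algebraMap_eq_smul_one]
  exact Ring.inverse_unit (⟨_, _, h1, h2⟩ : 𝔸ˣ)

/-- Adding the values at `ω` and `-ω` cancels the odd imaginary part and leaves `2 / (1 + ω²)`. -/
theorem integral_inv_one_add_imaginary (T : ℝ) :
    ∫ ω in (-T)..T, (Complex.I * (ω : ℂ) + 1)⁻¹ = ((2 * Real.arctan T : ℝ) : ℂ) := by
  have hne : ∀ ω : ℝ, Complex.I * (ω : ℂ) + 1 ≠ 0 := fun ω h => by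
    simpa using congrArg Complex.re h
  have hc : Continuous fun ω : ℝ => (Complex.I * (ω : ℂ) + 1)⁻¹ :=
    Continuous.inv₀ (by fun_prop) hne
  have h1 : ∫ ω in (-T)..T, (Complex.I * ((-ω : ℝ) : ℂ) + 1)⁻¹ =
      ∫ ω in (-T)..T, (Complex.I * (ω : ℂ) + 1)⁻¹ := by
    rw [intervalIntegral.integral_comp_neg (fun ω : ℝ => (Complex.I * (ω : ℂ) + 1)⁻¹)]
    simp
  have h2 : ∫ ω in (-T)..T, ((Complex.I * (ω : ℂ) + 1)⁻¹ + (Complex.I * ((-ω : ℝ) : ℂ) + 1)⁻¹)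
      = ∫ ω in (-T)..T, ((2 * (1 + ω ^ 2)⁻¹ : ℝ) : ℂ) := by
    refine intervalIntegral.integral_congr fun ω _ => ?_
    have a1 := hne ω
    have a2 := hne (-ω)
    have a3 : (Complex.I * (ω : ℂ) + 1) * (Complex.I * ((-ω : ℝ) : ℂ) + 1) = 1 + (ω : ℂ) ^ 2 := by
      push_cast
      linear_combination (-(ω : ℂ) ^ 2) * Complex.I_sq
    change (Complex.I * (ω : ℂ) + 1)⁻¹ + (Complex.I * ((-ω : ℝ) : ℂ) + 1)⁻¹ = _
    rw [inv_add_inv a1 a2, a3]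
    push_cast
    ring
  have hc' : Continuous fun ω : ℝ => (Complex.I * ((-ω : ℝ) : ℂ) + 1)⁻¹ := hc.comp continuous_neg
  rw [intervalIntegral.integral_add (hc.intervalIntegrable _ _) (hc'.intervalIntegrable _ _), h1,
    intervalIntegral.integral_ofReal, intervalIntegral.integral_const_mul] at h2
  rw [integral_inv_one_add_sq, Real.arctan_neg] at h2
  push_cast at h2 ⊢
  linear_combination h2 / 2

/-- The integrand is in general not absolutely integrable, hence the symmetric truncation.
Comparison with `a = -1` reduces the limit to `2 arctan T → π`. -/
theorem tendsto_integral_resolvent {a : 𝔸} (ha : ∀ s ∈ spectrum ℂ a, s.re < 0) :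
    Tendsto (fun T : ℝ => ∫ ω in (-T)..T, resolvent a (Complex.I * (ω : ℂ))) atTop
      (𝓝 ((Real.pi : ℂ) • (1 : 𝔸))) := by
  have hne : ∀ s : ℂ, 0 ≤ s.re → s + 1 ≠ 0 := fun s hs h => by
    have := congrArg Complex.re h
    simp at this
    linarith
  have hb : ∀ s ∈ spectrum ℂ (-1 : 𝔸), s.re < 0 := by
    intro s hs
    by_contra h
    refine hs ?_
    have e : algebraMap ℂ 𝔸 s - -1 = algebraMap ℂ 𝔸 (s + 1) := by simp
    change IsUnit _
    rw [e]
    exact (IsUnit.mk0 _ (hne s (not_lt.mp h))).map _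
  have h := tendsto_integral_resolvent_sub ha hb
  have h2 : Tendsto (fun T : ℝ => ((2 * Real.arctan T : ℝ) : ℂ) • (1 : 𝔸)) atTop
      (𝓝 ((Real.pi : ℂ) • (1 : 𝔸))) := by
    refine Tendsto.smul_const ?_ _
    refine (Complex.continuous_ofReal.tendsto _).comp ?_
    have := (tendsto_nhds_of_tendsto_nhdsWithin Real.tendsto_arctan_atTop).const_mul 2
    rwa [mul_div_cancel₀ _ two_ne_zero] at this
  have h3 := h.add h2
  rw [zero_add] at h3
  refine h3.congr fun T => ?_
  rw [intervalIntegral.integral_sub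
    ((continuous_resolvent_imaginary_axis ha).intervalIntegrable _ _)
    ((continuous_resolvent_imaginary_axis hb).intervalIntegrable _ _)]
  rw [← integral_inv_one_add_imaginary, ← intervalIntegral.integral_smul_const]
  rw [intervalIntegral.integral_congr (g := fun ω : ℝ => resolvent (-1 : 𝔸) (Complex.I * (ω : ℂ)))
    (f := fun ω : ℝ => (Complex.I * (ω : ℂ) + 1)⁻¹ • (1 : 𝔸))]
  · simp
  · intro ω _
    exact (resolvent_neg_one (hne _ (by simp))).symm

omit [CompleteSpace 𝔸] in
theorem mul_resolvent_imaginary_axis {a : 𝔸} (ha : ∀ s ∈ spectrum ℂ a, s.re < 0) (ω : ℝ) :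
    a * resolvent a (Complex.I * (ω : ℂ)) =
      (Complex.I * (ω : ℂ)) • resolvent a (Complex.I * (ω : ℂ)) - 1 := by
  have h := Ring.mul_inverse_cancel _
    (mem_resolventSet_of_stable ha (s := Complex.I * (ω : ℂ)) (by simp))
  rw [sub_mul, ← Algebra.smul_def] at h
  rw [resolvent, ← h]
  abel

omit [CompleteSpace 𝔸] in
theorem resolvent_mul_imaginary_axis {a : 𝔸} (ha : ∀ s ∈ spectrum ℂ a, s.re < 0) (ω : ℝ) :
    resolvent a (Complex.I * (ω : ℂ)) * a =
      (Complex.I * (ω : ℂ)) • resolvent a (Complex.I * (ω : ℂ)) - 1 := by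
  have h := Ring.inverse_mul_cancel _
    (mem_resolventSet_of_stable ha (s := Complex.I * (ω : ℂ)) (by simp))
  rw [mul_sub, ← Algebra.commutes, ← Algebra.smul_def] at h
  rw [resolvent, ← h]
  abel

end Resolvent

/-! ### The Gramian and the Lyapunov equation in a complete normed star algebra -/

section Gramian

variable {𝔸 : Type*} [NormedRing 𝔸] [NormedAlgebra ℂ 𝔸] [CompleteSpace 𝔸] [StarRing 𝔸]
  [NormedStarGroup 𝔸] [StarModule ℂ 𝔸]

omit [StarModule ℂ 𝔸] in
theorem continuous_gramian_integrand {a : 𝔸} (ha : ∀ s ∈ spectrum ℂ a, s.re < 0) (w : 𝔸) :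
    Continuous fun ω : ℝ =>
      resolvent a (Complex.I * (ω : ℂ)) * w * star (resolvent a (Complex.I * (ω : ℂ))) :=
  ((continuous_resolvent_imaginary_axis ha).mul continuous_const).mul
    (continuous_resolvent_imaginary_axis ha).star

omit [StarModule ℂ 𝔸] in
theorem integrable_gramian_integrand {a : 𝔸} (ha : ∀ s ∈ spectrum ℂ a, s.re < 0) (w : 𝔸) :
    Integrable fun ω : ℝ =>
      resolvent a (Complex.I * (ω : ℂ)) * w * star (resolvent a (Complex.I * (ω : ℂ))) := by
  refine (continuous_gramian_integrand ha w).locallyIntegrable.integrable_of_isBigO_cocompact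
    (g := fun ω : ℝ => (1 + ω ^ 2)⁻¹) ?_ (integrable_inv_one_add_sq.integrableAtFilter _)
  have h1 : resolvent a =O[cobounded ℂ] fun s => ‖s‖⁻¹ := by
    exact (spectrum.resolvent_isBigO_inv (𝕜 := ℂ) a).norm_right.congr_right fun s => norm_inv s
  have ht : Tendsto (fun ω : ℝ => Complex.I * (ω : ℂ)) (cobounded ℝ) (cobounded ℂ) := by
    rw [← tendsto_norm_atTop_iff_cobounded]
    refine (tendsto_norm_cobounded_atTop (E := ℝ)).congr fun ω => ?_
    rw [norm_mul, Complex.norm_I, one_mul, Complex.norm_real]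
  have h2 := h1.comp_tendsto ht
  have h3 : (fun ω : ℝ => star (resolvent a (Complex.I * (ω : ℂ))))
      =O[cobounded ℝ] ((fun s : ℂ => ‖s‖⁻¹) ∘ fun ω : ℝ => Complex.I * (ω : ℂ)) :=
    h2.norm_left.congr_left (fun ω => (norm_star _).symm) |>.of_norm_left
  rw [← Metric.cobounded_eq_cocompact]
  refine ((h2.mul (isBigO_const_const w (one_ne_zero (α := ℝ)) _)).mul h3).trans ?_
  -- The constant 2 works once `|ω| > 1`, since then `1 + ω² ≤ 2ω²`.
  refine IsBigO.of_bound 2 ?_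
  have h4 : ∀ᶠ ω : ℝ in cobounded ℝ, 1 < ‖ω‖ :=
    (tendsto_norm_cobounded_atTop (E := ℝ)).eventually_gt_atTop 1
  filter_upwards [h4] with ω hω
  have : (0 : ℝ) < ‖ω‖ := by linarith
  have h5 : (‖ω‖ ^ 2)⁻¹ ≤ 2 * (1 + ‖ω‖ ^ 2)⁻¹ := by
    rw [inv_le_iff_one_le_mul₀ (by positivity)]
    field_simp
    nlinarith
  have h6 : 0 < 1 + ω ^ 2 := by positivity
  simpa [abs_of_pos h6, ← mul_inv, ← sq] using h5

/-- The Gramian integral, in the frequency domain. -/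
def gramian (a w : 𝔸) : 𝔸 :=
  ∫ ω : ℝ, resolvent a (Complex.I * (ω : ℂ)) * w * star (resolvent a (Complex.I * (ω : ℂ)))

omit [StarModule ℂ 𝔸] in
theorem tendsto_gramian {a : 𝔸} (ha : ∀ s ∈ spectrum ℂ a, s.re < 0) (w : 𝔸) :
    Tendsto (fun T : ℝ => ∫ ω in (-T)..T,
      resolvent a (Complex.I * (ω : ℂ)) * w * star (resolvent a (Complex.I * (ω : ℂ))))
      atTop (𝓝 (gramian a w)) :=
  intervalIntegral_tendsto_integral (integrable_gramian_integrand ha w) tendsto_neg_atTop_atBot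
    tendsto_id

/-- Each summand is the image of the resolvent under a continuous map and contributes `π w`. The
maps are taken real-linear because `star` is only conjugate-linear over `ℂ`. Both the existence and
the uniqueness of Lyapunov solutions reduce to this limit. -/
theorem tendsto_integral_resolvent_symm {a : 𝔸} (ha : ∀ s ∈ spectrum ℂ a, s.re < 0) (w : 𝔸) :
    Tendsto (fun T : ℝ => ∫ ω in (-T)..T, (w * star (resolvent a (Complex.I * (ω : ℂ)))
      + resolvent a (Complex.I * (ω : ℂ)) * w)) atTop (𝓝 ((2 * Real.pi : ℂ) • w)) := by
  have hc := continuous_resolvent_imaginary_axis ha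
  have h := tendsto_integral_resolvent ha
  have h2 : Tendsto (fun T : ℝ => w * star (∫ ω in (-T)..T, resolvent a (Complex.I * (ω : ℂ)))
      + (∫ ω in (-T)..T, resolvent a (Complex.I * (ω : ℂ))) * w) atTop
      (𝓝 (w * star ((Real.pi : ℂ) • (1 : 𝔸)) + ((Real.pi : ℂ) • (1 : 𝔸)) * w)) :=
    (h.star.const_mul w).add (h.mul_const w)
  have e : w * star ((Real.pi : ℂ) • (1 : 𝔸)) + ((Real.pi : ℂ) • (1 : 𝔸)) * w
      = (2 * Real.pi : ℂ) • w := by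
    rw [star_smul]
    simp [two_mul, add_smul]
  rw [e] at h2
  refine h2.congr fun T => ?_
  rw [intervalIntegral.integral_add]
  · congr 1
    · have := ContinuousLinearMap.intervalIntegral_comp_comm
        ((ContinuousLinearMap.mul ℝ 𝔸 w).comp
          (starL' ℝ (A := 𝔸) : 𝔸 →L[ℝ] 𝔸)) (hc.intervalIntegrable (μ := volume) (-T) T)
      simpa using this.symm
    · have := ContinuousLinearMap.intervalIntegral_comp_comm
        ((ContinuousLinearMap.mul ℝ 𝔸).flip w) (hc.intervalIntegrable (μ := volume) (-T) T)
      simpa using this.symm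
  · exact (continuous_const.mul hc.star).intervalIntegrable _ _
  · exact (hc.mul continuous_const).intervalIntegrable _ _

/-- The Gramian solves the Lyapunov equation. -/
theorem lyapunov_gramian {a : 𝔸} (ha : ∀ s ∈ spectrum ℂ a, s.re < 0) (w : 𝔸) :
    a * gramian a w + gramian a w * star a = -((2 * Real.pi : ℂ) • w) := by
  have h1 := ((tendsto_gramian ha w).const_mul a).add ((tendsto_gramian ha w).mul_const (star a))
  refine tendsto_nhds_unique h1 ((tendsto_integral_resolvent_symm ha w).neg.congr fun T => ?_)
  have hi : IntervalIntegrable (fun ω : ℝ => resolvent a (Complex.I * (ω : ℂ)) * w *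
    star (resolvent a (Complex.I * (ω : ℂ)))) volume (-T) T :=
    (continuous_gramian_integrand ha w).intervalIntegrable _ _
  have e1 := ContinuousLinearMap.intervalIntegral_comp_comm (ContinuousLinearMap.mul ℝ 𝔸 a) hi
  have e2 := ContinuousLinearMap.intervalIntegral_comp_comm
    ((ContinuousLinearMap.mul ℝ 𝔸).flip (star a)) hi
  simp only [ContinuousLinearMap.mul_apply', ContinuousLinearMap.flip_apply] at e1 e2
  rw [← e1, ← e2, ← intervalIntegral.integral_add, ← intervalIntegral.integral_neg]
  · refine intervalIntegral.integral_congr fun ω _ => ?_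
    -- With `a R = iω R - 1` and its adjoint, the terms `± iω R w R*` cancel because `iω` is purely
    -- imaginary, leaving `-(w R* + R w)`.
    have h2 := mul_resolvent_imaginary_axis ha ω
    have h3 := congrArg star h2
    simp only [star_mul, star_sub, star_smul, star_one, Complex.star_def, Complex.conj_I,
      Complex.conj_ofReal, mul_neg, mul_comm (ω : ℂ) Complex.I] at h3
    change _ = a * (_ * w * _) + (_ * w * _) * star a
    rw [mul_assoc _ _ (star a), h3, ← mul_assoc, ← mul_assoc, h2]
    simp only [sub_mul, mul_sub, smul_mul_assoc, mul_smul_comm, one_mul, mul_one, neg_smul,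
      mul_neg]
    abel
  · exact (continuous_const.mul (continuous_gramian_integrand ha w)).intervalIntegrable _ _
  · exact ((continuous_gramian_integrand ha w).mul continuous_const).intervalIntegrable _ _

/-- A solution of the Lyapunov equation is the Gramian. -/
theorem gramian_of_lyapunov {a p w : 𝔸} (ha : ∀ s ∈ spectrum ℂ a, s.re < 0)
    (h : a * p + p * star a = -w) : gramian a w = (2 * Real.pi : ℂ) • p := by
  refine tendsto_nhds_unique (tendsto_gramian ha w)
    ((tendsto_integral_resolvent_symm ha p).congr fun T => ?_)
  refine intervalIntegral.integral_congr fun ω _ => ?_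
  have h2 := resolvent_mul_imaginary_axis ha ω
  have h3 := congrArg star h2
  simp only [star_mul, star_sub, star_smul, star_one, Complex.star_def, Complex.conj_I,
    Complex.conj_ofReal, mul_neg, mul_comm (ω : ℂ) Complex.I] at h3
  -- Substituting for `w` and using `R a = iω R - 1`, the same cancellation turns `R w R*` into `p
  -- R* + R p`.
  have h4 : w = -(a * p) - p * star a := by rw [← neg_eq_iff_eq_neg.mpr h]; abel
  change _ = resolvent a _ * w * _
  rw [h4, mul_sub, sub_mul, mul_neg, neg_mul, ← mul_assoc, h2, mul_assoc (resolvent a _) (p * _),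
    mul_assoc p, h3]
  simp only [sub_mul, mul_sub, smul_mul_assoc, mul_smul_comm, one_mul, mul_one, neg_smul,
    mul_neg, mul_assoc]
  abel

end Gramian

/-! ### Positive definite matrices: complexification and openness -/

section Positivity

open scoped MatrixOrder

variable {n : Type*} [Fintype n] [DecidableEq n]

theorem conjTranspose_map_ofReal {m n : Type*} (M : Matrix m n ℝ) :
    (M.map Complex.ofReal)ᴴ = Mᵀ.map Complex.ofReal := by
  ext i j
  simp

theorem map_ofReal_mul {l m n : Type*} [Fintype m] (M : Matrix l m ℝ) (N : Matrix m n ℝ) :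
    (M * N).map Complex.ofReal = M.map Complex.ofReal * N.map Complex.ofReal :=
  Matrix.map_mul (f := Complex.ofRealHom)

theorem posSemidef_map_ofReal {M : Matrix n n ℝ} (hM : M.PosSemidef) :
    (M.map Complex.ofReal).PosSemidef := by
  obtain ⟨N, rfl⟩ := CStarAlgebra.nonneg_iff_eq_star_mul_self.mp hM.nonneg
  rw [map_ofReal_mul, star_eq_conjTranspose, conjTranspose_eq_transpose_of_trivial,
    ← conjTranspose_map_ofReal]
  exact posSemidef_conjTranspose_mul_self _

theorem posDef_map_ofReal {M : Matrix n n ℝ} (hM : M.PosDef) :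
    (M.map Complex.ofReal).PosDef := by
  rw [(posSemidef_map_ofReal hM.posSemidef).posDef_iff_isUnit]
  exact hM.isUnit.map (Complex.ofRealHom.mapMatrix (m := n))

omit [DecidableEq n] in
theorem map_re_posSemidef {M : Matrix n n ℂ} (hM : M.PosSemidef) :
    (M.map Complex.re).PosSemidef := by
  refine PosSemidef.of_dotProduct_mulVec_nonneg ?_ fun x => ?_
  · ext i j
    have := congrFun (congrFun hM.isHermitian i) j
    simpa using congrArg Complex.re this
  · have h := hM.dotProduct_mulVec_nonneg (fun i => (x i : ℂ))
    have h2 := (Complex.le_def.mp h).1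
    simpa [dotProduct, mulVec] using h2

/-- Factoring `V = N* N` gives `V + tU = N* (1 + tK) N` with `K` Hermitian, so it is enough that
`tK` has a small quadratic form. -/
theorem posDef_add_smul_eventually {V U : Matrix n n ℝ} (hV : V.PosDef) (hU : U.IsHermitian) :
    ∀ᶠ t : ℝ in 𝓝 0, (V + t • U).PosDef := by
  obtain ⟨N, hN, rfl⟩ := CStarAlgebra.isStrictlyPositive_iff_eq_star_mul_self.mp
    hV.isStrictlyPositive
  set K : Matrix n n ℝ := star N⁻¹ * U * N⁻¹ with hK
  have hNd : IsUnit N.det := (isUnit_iff_isUnit_det N).mp hN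
  have hKh : K.IsHermitian := by
    have := isHermitian_conjTranspose_mul_mul N⁻¹ hU
    rwa [star_eq_conjTranspose] at hK
  have hU' : U = star N * K * N := by
    have h1 : star N * star N⁻¹ = 1 := by rw [← star_mul, nonsing_inv_mul _ hNd, star_one]
    rw [hK]
    simp only [mul_assoc, nonsing_inv_mul _ hNd, mul_one]
    rw [← mul_assoc, h1, one_mul]
  -- A crude bound for the quadratic form of `K`, from `|x i| |x j| ≤ x ⬝ᵥ x`.
  set c : ℝ := ∑ i, ∑ j, |K i j| with hc
  have hb : ∀ x : n → ℝ, |x ⬝ᵥ K *ᵥ x| ≤ c * (x ⬝ᵥ x) := by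
    intro x
    have hx : ∀ i, |x i| ^ 2 ≤ x ⬝ᵥ x := fun i => by
      rw [sq_abs, sq]
      exact Finset.single_le_sum (f := fun i => x i * x i) (fun i _ => mul_self_nonneg _)
        (Finset.mem_univ i)
    rw [hc, Finset.sum_mul]
    simp only [Finset.sum_mul]
    change |∑ i, x i * ∑ j, K i j * x j| ≤ _
    simp only [Finset.mul_sum]
    refine (Finset.abs_sum_le_sum_abs _ _).trans (Finset.sum_le_sum fun i _ => ?_)
    refine (Finset.abs_sum_le_sum_abs _ _).trans (Finset.sum_le_sum fun j _ => ?_)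
    rw [abs_mul, abs_mul]
    have h1 := hx i
    have h2 := hx j
    have h3 : |x i| * |x j| ≤ x ⬝ᵥ x := by nlinarith [sq_nonneg (|x i| - |x j|)]
    nlinarith [abs_nonneg (K i j)]
  have hlim : ∀ᶠ t : ℝ in 𝓝 0, |t| * c < 1 := by
    have : Tendsto (fun t : ℝ => |t| * c) (𝓝 0) (𝓝 (|0| * c)) :=
      (Continuous.tendsto (by fun_prop) 0)
    rw [abs_zero, zero_mul] at this
    exact this.eventually_lt_const one_pos
  filter_upwards [hlim] with t ht
  have h1 : (1 + t • K).PosDef := by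
    refine PosDef.of_dotProduct_mulVec_pos (isHermitian_one.add ?_) fun x hx => ?_
    · rw [IsHermitian, conjTranspose_smul, hKh]; simp
    · have hxx : 0 < x ⬝ᵥ x := by
        simpa using dotProduct_star_self_pos_iff.mpr hx
      rw [add_mulVec, one_mulVec, smul_mulVec, dotProduct_add, dotProduct_smul, smul_eq_mul,
        star_trivial]
      have h2 := neg_abs_le (t * (x ⬝ᵥ K *ᵥ x))
      rw [abs_mul] at h2
      have h3 := mul_le_mul_of_nonneg_left (hb x) (abs_nonneg t)
      nlinarith
  have h2 : star N * N + t • U = star N * (1 + t • K) * N := by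
    rw [mul_add, add_mul, mul_one, mul_smul_comm, smul_mul_assoc, ← hU']
  rw [h2]
  exact (IsUnit.posDef_star_left_conjugate_iff hN).mpr h1

end Positivity

/-! ### Lyapunov certificates and stability -/

section Lyapunov

variable {n w z : Type*} [Fintype n] [DecidableEq n] [Fintype w] [Fintype z]

/-- `P` certifies stability and the `H₂` bound `γ` for the realization `(A, B, C)`. -/
def IsH2Certificate (A : Matrix n n ℝ) (B : Matrix n w ℝ) (C : Matrix z n ℝ) (γ : ℝ)
    (P : Matrix n n ℝ) : Prop :=
  P.PosDef ∧ (-(A * P + P * Aᵀ + B * Bᵀ)).PosDef ∧ (C * P * Cᵀ).trace < γ ^ 2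

/-- All three conditions are strict and affine in `P`. This freedom is used later to make the
off-diagonal block of `P` nondegenerate. -/
theorem IsH2Certificate.add_smul_eventually {A : Matrix n n ℝ} {B : Matrix n w ℝ}
    {C : Matrix z n ℝ} {γ : ℝ} {P : Matrix n n ℝ} (h : IsH2Certificate A B C γ P)
    {E : Matrix n n ℝ} (hE : E.IsHermitian) :
    ∀ᶠ t : ℝ in 𝓝 0, IsH2Certificate A B C γ (P + t • E) := by
  obtain ⟨h1, h2, h3⟩ := h
  have hE' : (-(A * E + E * Aᵀ)).IsHermitian := by
    have hEt : Eᵀ = E := by rw [← conjTranspose_eq_transpose_of_trivial]; exact hE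
    rw [IsHermitian, conjTranspose_eq_transpose_of_trivial]
    simp only [transpose_neg, transpose_add, transpose_mul, transpose_transpose, hEt]
    rw [add_comm]
  have e3 : ∀ᶠ t : ℝ in 𝓝 0, (C * (P + t • E) * Cᵀ).trace < γ ^ 2 := by
    have : Tendsto (fun t : ℝ => (C * (P + t • E) * Cᵀ).trace) (𝓝 0)
        (𝓝 ((C * (P + (0 : ℝ) • E) * Cᵀ).trace)) := (Continuous.tendsto (by fun_prop) 0)
    rw [zero_smul, add_zero] at this
    exact this.eventually_lt_const h3
  filter_upwards [posDef_add_smul_eventually h1 hE, posDef_add_smul_eventually h2 hE', e3]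
    with t t1 t2 t3
  refine ⟨t1, ?_, t3⟩
  convert t2 using 1
  simp only [mul_add, add_mul, mul_smul_comm, smul_mul_assoc, smul_neg, smul_add]
  abel

/-- For a left eigenvector `v` with eigenvalue `s`, the inequality gives `2 Re(s) · v P v* < -v W v*
≤ 0`, while `v P v* > 0`. -/
theorem isHurwitz_of_lyapunov {A P W : Matrix n n ℝ} (hP : P.PosDef)
    (hW : W.PosSemidef) (hL : (-(A * P + P * Aᵀ + W)).PosDef) : IsHurwitz A := by
  intro s hs
  set a := A.map Complex.ofReal with ha
  have hdet : (s • (1 : Matrix n n ℂ) - a).det = 0 := by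
    rw [spectrum.mem_iff, Algebra.algebraMap_eq_smul_one, isUnit_iff_isUnit_det] at hs
    simpa using hs
  obtain ⟨v, hv, hv0⟩ := exists_vecMul_eq_zero_iff.mpr hdet
  have hva : v ᵥ* a = s • v := by
    rw [vecMul_sub, vecMul_smul, vecMul_one, sub_eq_zero] at hv0
    exact hv0.symm
  have hva' : aᴴ *ᵥ star v = star s • star v := by
    rw [← star_vecMul, hva, star_smul]
  have hsv : star v ≠ 0 := by simpa using hv
  have hp := (posDef_map_ofReal hP).dotProduct_mulVec_pos hsv
  have hw := (posSemidef_map_ofReal hW).dotProduct_mulVec_nonneg (star v)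
  have hl := (posDef_map_ofReal hL).dotProduct_mulVec_pos hsv
  have e : (-(A * P + P * Aᵀ + W)).map Complex.ofReal =
      -(a * P.map Complex.ofReal + P.map Complex.ofReal * aᴴ + W.map Complex.ofReal) := by
    rw [ha, conjTranspose_map_ofReal, ← map_ofReal_mul, ← map_ofReal_mul]
    ext i j
    simp
  rw [e, star_star] at hl
  rw [star_star] at hp hw
  rw [neg_mulVec, add_mulVec, add_mulVec, dotProduct_neg, dotProduct_add, dotProduct_add,
    ← mulVec_mulVec, ← mulVec_mulVec, dotProduct_mulVec v a, hva, hva', mulVec_smul,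
    smul_dotProduct, dotProduct_smul, ← add_smul] at hl
  obtain ⟨r, hr⟩ : ∃ r : ℝ, v ⬝ᵥ P.map Complex.ofReal *ᵥ star v = r :=
    ⟨_, Complex.ext rfl (by simpa using (Complex.lt_def.mp hp).2.symm)⟩
  rw [hr] at hl hp
  have h1 := (Complex.lt_def.mp hl).1
  have h2 := (Complex.le_def.mp hw).1
  have h3 := (Complex.lt_def.mp hp).1
  simp at h1 h2 h3
  nlinarith

end Lyapunov

/-! ### The `H₂` norm through the real controllability Gramian -/

section Gramian

-- The operator norm makes complex square matrices a complete normed star algebra, to which the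
-- abstract Gramian results apply.
open scoped Matrix.Norms.L2Operator

variable {n w z : Type*} [Fintype n] [DecidableEq n] [Fintype w] [Fintype z]

theorem trace_mul_gramian {a : Matrix n n ℂ} (ha : ∀ s ∈ spectrum ℂ a, s.re < 0)
    (K W : Matrix n n ℂ) :
    (Integrable fun ω : ℝ => (K * (resolvent a (Complex.I * (ω : ℂ)) * W *
      star (resolvent a (Complex.I * (ω : ℂ))))).trace) ∧
    (K * gramian a W).trace = ∫ ω : ℝ, (K * (resolvent a (Complex.I * (ω : ℂ)) * W *
      star (resolvent a (Complex.I * (ω : ℂ))))).trace := by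
  have hi := integrable_gramian_integrand ha W
  let L : Matrix n n ℂ →L[ℂ] ℂ :=
    LinearMap.toContinuousLinearMap ((traceLinearMap n ℂ ℂ).comp (LinearMap.mulLeft ℂ K))
  exact ⟨L.integrable_comp hi, (L.integral_comp_comm hi).symm⟩

theorem gramian_posSemidef {a : Matrix n n ℂ} (ha : ∀ s ∈ spectrum ℂ a, s.re < 0)
    {W : Matrix n n ℂ} (hW : W.PosSemidef) : (gramian a W).PosSemidef := by
  -- Writing the quadratic form as a trace against `x x*` lets `trace_mul_gramian` move it inside
  -- the integral.
  have e : ∀ (M : Matrix n n ℂ) (x : n → ℂ),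
      star x ⬝ᵥ M *ᵥ x = (vecMulVec x (star x) * M).trace := fun M x => by
    rw [trace_mul_comm, mul_vecMulVec, trace_vecMulVec, dotProduct_comm]
  refine PosSemidef.of_dotProduct_mulVec_nonneg ?_ fun x => ?_
  · have hi := integrable_gramian_integrand ha W
    have h := (starL' ℝ (A := Matrix n n ℂ) : Matrix n n ℂ →L[ℝ] Matrix n n ℂ).integral_comp_comm hi
    have h2 : star (gramian a W) = gramian a W := by
      refine Eq.trans h.symm (integral_congr_ae (Eventually.of_forall fun ω => ?_))
      have hW' : star W = W := hW.isHermitian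
      simp [hW', mul_assoc]
    exact h2
  · rw [e, (trace_mul_gramian ha _ W).2]
    refine integral_nonneg fun ω => ?_
    rw [← e]
    exact (hW.mul_mul_conjTranspose_same _).dotProduct_mulVec_nonneg x

/-- The controllability Gramian `(1 / 2π) ∫ (iω - A)⁻¹ W (iω - A)⁻ᴴ dω`. -/
def realGramian (A W : Matrix n n ℝ) : Matrix n n ℝ :=
  (1 / (2 * Real.pi)) •
    (gramian (A.map Complex.ofReal) (W.map Complex.ofReal)).map Complex.re

theorem realGramian_posSemidef {A W : Matrix n n ℝ} (hA : IsHurwitz A) (hW : W.PosSemidef) :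
    (realGramian A W).PosSemidef :=
  (map_re_posSemidef (gramian_posSemidef hA (posSemidef_map_ofReal hW))).smul (by positivity)

theorem map_re_ofReal_mul {l m n : Type*} [Fintype m] (M : Matrix l m ℝ) (N : Matrix m n ℂ) :
    (M.map Complex.ofReal * N).map Complex.re = M * N.map Complex.re := by
  ext i j
  simp [mul_apply]

theorem map_re_mul_ofReal {l m n : Type*} [Fintype m] (M : Matrix l m ℂ) (N : Matrix m n ℝ) :
    (M * N.map Complex.ofReal).map Complex.re = M.map Complex.re * N := by
  ext i j
  simp [mul_apply]

theorem lyapunov_realGramian {A : Matrix n n ℝ} (hA : IsHurwitz A) (W : Matrix n n ℝ) :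
    A * realGramian A W + realGramian A W * Aᵀ = -W := by
  have h := congrArg (fun M => M.map Complex.re)
    (lyapunov_gramian (a := A.map Complex.ofReal) hA (W.map Complex.ofReal))
  simp only [star_eq_conjTranspose, conjTranspose_map_ofReal] at h
  rw [Matrix.map_add _ Complex.add_re, map_re_ofReal_mul, map_re_mul_ofReal] at h
  rw [realGramian, mul_smul_comm, smul_mul_assoc, ← smul_add, h]
  ext i j
  have := Real.pi_ne_zero
  simp
  field_simp

theorem realGramian_of_lyapunov {A P W : Matrix n n ℝ} (hA : IsHurwitz A)
    (h : A * P + P * Aᵀ = -W) : realGramian A W = P := by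
  have h2 := gramian_of_lyapunov (a := A.map Complex.ofReal) (p := P.map Complex.ofReal)
    (w := W.map Complex.ofReal) hA (by
      rw [star_eq_conjTranspose, conjTranspose_map_ofReal, ← map_ofReal_mul, ← map_ofReal_mul,
        ← Matrix.map_add _ Complex.ofReal_add, h]
      ext i j
      simp)
  rw [realGramian, h2]
  ext i j
  have := Real.pi_ne_zero
  simp
  field_simp

/-- If `x` is in the kernel of the Gramian `G`, then the form of `A G + G Aᵀ = -1` at `x` vanishes,
so `x ⬝ᵥ x = 0`. -/
theorem realGramian_one_posDef {A : Matrix n n ℝ} (hA : IsHurwitz A) :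
    (realGramian A 1).PosDef := by
  have hP := realGramian_posSemidef hA (PosSemidef.one (n := n))
  have hL := lyapunov_realGramian hA 1
  refine PosDef.of_dotProduct_mulVec_pos hP.isHermitian fun x hx => ?_
  refine (hP.dotProduct_mulVec_nonneg x).lt_of_ne fun h0 => hx ?_
  have h1 : realGramian A 1 *ᵥ x = 0 := (hP.dotProduct_mulVec_zero_iff x).mp h0.symm
  have h2 : x ᵥ* realGramian A 1 = 0 := by
    have := hP.isHermitian
    rw [IsHermitian, conjTranspose_eq_transpose_of_trivial] at this
    rw [← mulVec_transpose, this, h1]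
  have h3 := congrArg (fun M => x ⬝ᵥ M *ᵥ x) hL
  simp only [add_mulVec, ← mulVec_mulVec, h1, mulVec_zero,
    dotProduct_mulVec x (realGramian A 1), h2, zero_dotProduct, neg_mulVec, one_mulVec,
    dotProduct_neg, zero_add] at h3
  have : x ⬝ᵥ x = 0 := by linarith
  simpa using this

omit [Fintype w] [Fintype z] in
theorem transferFun_eq_resolvent (A : Matrix n n ℝ) (B : Matrix n w ℝ) (C : Matrix z n ℝ)
    (D : Matrix z w ℝ) (s : ℂ) :
    transferFun A B C D s = C.map Complex.ofReal * resolvent (A.map Complex.ofReal) s *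
      B.map Complex.ofReal + D.map Complex.ofReal := by
  rw [transferFun, nonsing_inv_eq_ringInverse, resolvent, Algebra.algebraMap_eq_smul_one]

/-- For a stable strictly proper transfer function, the `H₂` norm is given by the Gramian. -/
theorem h2Norm_transferFun_zero {A : Matrix n n ℝ} (hA : IsHurwitz A) (B : Matrix n w ℝ)
    (C : Matrix z n ℝ) :
    0 ≤ (C * realGramian A (B * Bᵀ) * Cᵀ).trace ∧
    h2Norm (transferFun A B C 0) =
      ENNReal.ofReal (C * realGramian A (B * Bᵀ) * Cᵀ).trace ^ (1 / 2 : ℝ) := by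
  have hBB : (B * Bᵀ).PosSemidef := by
    rw [← conjTranspose_eq_transpose_of_trivial]
    exact posSemidef_self_mul_conjTranspose B
  have hpos := realGramian_posSemidef hA hBB
  have h0 := (hpos.mul_mul_conjTranspose_same C).trace_nonneg
  rw [conjTranspose_eq_transpose_of_trivial] at h0
  refine ⟨h0, ?_⟩
  set a := A.map Complex.ofReal with ha
  set c := C.map Complex.ofReal with hc
  set b := B.map Complex.ofReal with hb
  obtain ⟨hi, he⟩ := trace_mul_gramian (a := a) hA (cᴴ * c) ((B * Bᵀ).map Complex.ofReal)
  -- Cyclicity of the trace: `tr (G* G) = tr (C* C · R B B* R*)`, the Gramian integrand weighted by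
  -- `C* C`.
  have e : ∀ ω : ℝ, (((transferFun A B C 0 (Complex.I * (ω : ℂ)))ᴴ *
      transferFun A B C 0 (Complex.I * (ω : ℂ))).trace) =
      ((cᴴ * c) * (resolvent a (Complex.I * (ω : ℂ)) * (B * Bᵀ).map Complex.ofReal *
      star (resolvent a (Complex.I * (ω : ℂ))))).trace := by
    intro ω
    have hz : (0 : Matrix z w ℝ).map Complex.ofReal = 0 := by ext; simp
    rw [transferFun_eq_resolvent, ← ha, ← hb, ← hc, hz, add_zero, map_ofReal_mul,
      ← conjTranspose_map_ofReal, ← hb, star_eq_conjTranspose, trace_mul_comm]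
    simp only [conjTranspose_mul]
    rw [Matrix.mul_assoc cᴴ c, trace_mul_comm cᴴ]
    simp only [Matrix.mul_assoc]
  have hre := (Complex.reCLM.integral_comp_comm hi).symm
  have hint := Complex.reCLM.integrable_comp hi
  simp only [Complex.reCLM_apply, ← he] at hre
  have key : (∫⁻ ω : ℝ, ENNReal.ofReal (((transferFun A B C 0 (Complex.I * (ω : ℂ)))ᴴ *
      transferFun A B C 0 (Complex.I * (ω : ℂ))).trace.re)) =
      ENNReal.ofReal (2 * Real.pi * (C * realGramian A (B * Bᵀ) * Cᵀ).trace) := by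
    have h1 : 2 * Real.pi * (C * realGramian A (B * Bᵀ) * Cᵀ).trace =
        (cᴴ * c * gramian a ((B * Bᵀ).map Complex.ofReal)).trace.re := by
      have h2 : ∀ M : Matrix z z ℂ, M.trace.re = (M.map Complex.re).trace := fun M => by
        simp [trace]
      rw [Matrix.mul_assoc cᴴ, trace_mul_comm cᴴ, hc, conjTranspose_map_ofReal, h2, map_re_mul_ofReal,
        map_re_ofReal_mul, realGramian, Matrix.mul_smul, Matrix.smul_mul, trace_smul, smul_eq_mul, ← ha]
      have := Real.pi_ne_zero
      field_simp
    rw [h1, hre, ofReal_integral_eq_lintegral_ofReal]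
    · simp only [e]
    · exact hint
    · refine Eventually.of_forall fun ω => ?_
      change 0 ≤ Complex.re _
      rw [← e]
      exact (Complex.le_def.mp (posSemidef_conjTranspose_mul_self _).trace_nonneg).1
  rw [h2Norm, key, ← ENNReal.ofReal_mul (by positivity)]
  congr 2
  have := Real.pi_ne_zero
  field_simp

/-- Since `G(iω) → D`, the integrand eventually exceeds half of `tr (D* D) > 0`, on a half-line of
infinite measure. -/
theorem h2Norm_transferFun_eq_top (A : Matrix n n ℝ) (B : Matrix n w ℝ)
    (C : Matrix z n ℝ) {D : Matrix z w ℝ} (hD : D ≠ 0) : h2Norm (transferFun A B C D) = ⊤ := by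
  set d := D.map Complex.ofReal with hd
  have hd0 : d ≠ 0 := fun h => hD (by
    ext i j
    simpa [hd] using congrFun (congrFun h i) j)
  have hδ : 0 < (dᴴ * d).trace.re := by
    have h1 := (posSemidef_conjTranspose_mul_self d).trace_nonneg
    have h2 : (dᴴ * d).trace ≠ 0 := fun h => hd0 (trace_conjTranspose_mul_self_eq_zero_iff.mp h)
    exact (Complex.lt_def.mp (h1.lt_of_ne h2.symm)).1
  have ht : Tendsto (fun ω : ℝ => Complex.I * (ω : ℂ)) atTop (cobounded ℂ) := by
    rw [← tendsto_norm_atTop_iff_cobounded]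
    refine tendsto_norm_atTop_atTop.congr fun ω => ?_
    rw [norm_mul, Complex.norm_I, one_mul, Complex.norm_real]
  have hR := (spectrum.resolvent_tendsto_cobounded (𝕜 := ℂ) (A.map Complex.ofReal)).comp ht
  let φ : Matrix n n ℂ → ℝ := fun R =>
    ((C.map Complex.ofReal * R * B.map Complex.ofReal + d)ᴴ *
      (C.map Complex.ofReal * R * B.map Complex.ofReal + d)).trace.re
  have hφ : Continuous φ := by fun_prop
  have hlim := (hφ.tendsto 0).comp hR
  have hφ0 : φ 0 = (dᴴ * d).trace.re := by simp [φ]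
  rw [hφ0] at hlim
  obtain ⟨T, hT⟩ := eventually_atTop.mp (hlim.eventually_const_lt (half_lt_self hδ))
  have hint : (∫⁻ ω : ℝ, ENNReal.ofReal (((transferFun A B C D (Complex.I * (ω : ℂ)))ᴴ *
      transferFun A B C D (Complex.I * (ω : ℂ))).trace.re)) = ⊤ := by
    rw [eq_top_iff]
    calc (⊤ : ENNReal) = ∫⁻ _ in Set.Ioi T, ENNReal.ofReal ((dᴴ * d).trace.re / 2) := by
          rw [setLIntegral_const, Real.volume_Ioi, ENNReal.mul_top]
          simpa using hδ
      _ ≤ ∫⁻ ω in Set.Ioi T, ENNReal.ofReal (((transferFun A B C D (Complex.I * (ω : ℂ)))ᴴ *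
            transferFun A B C D (Complex.I * (ω : ℂ))).trace.re) := by
          refine setLIntegral_mono' measurableSet_Ioi fun ω hω => ?_
          refine ENNReal.ofReal_le_ofReal ?_
          rw [transferFun_eq_resolvent]
          exact (hT ω (le_of_lt hω)).le
      _ ≤ _ := setLIntegral_le_lintegral _ _
  rw [h2Norm, hint, ENNReal.mul_top, ENNReal.top_rpow_of_pos (by norm_num)]
  simpa using Real.pi_pos

/-- From the norm to a certificate, `P` is the Gramian of `B Bᵀ` plus `ε` times that of `I`; the
Lyapunov residual is then exactly `ε I`, and small `ε` preserves the trace bound. -/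
theorem stable_h2Norm_lt_iff (A : Matrix n n ℝ) (B : Matrix n w ℝ) (C : Matrix z n ℝ)
    (D : Matrix z w ℝ) {γ : ℝ} (hγ : 0 < γ) :
    (IsHurwitz A ∧ h2Norm (transferFun A B C D) < ENNReal.ofReal γ) ↔
      D = 0 ∧ ∃ P, IsH2Certificate A B C γ P := by
  have hBB : (B * Bᵀ).PosSemidef := by
    rw [← conjTranspose_eq_transpose_of_trivial]
    exact posSemidef_self_mul_conjTranspose B
  have hnorm : IsHurwitz A → (h2Norm (transferFun A B C 0) < ENNReal.ofReal γ ↔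
      (C * realGramian A (B * Bᵀ) * Cᵀ).trace < γ ^ 2) := by
    intro hA
    obtain ⟨h0, h1⟩ := h2Norm_transferFun_zero hA B C
    rw [h1, ENNReal.ofReal_rpow_of_nonneg h0 (by norm_num), ENNReal.ofReal_lt_ofReal_iff hγ,
      ← Real.sqrt_eq_rpow, Real.sqrt_lt' hγ]
  constructor
  · rintro ⟨hA, h⟩
    have hD : D = 0 := by
      by_contra hD
      rw [h2Norm_transferFun_eq_top A B C hD] at h
      exact not_top_lt h
    subst hD
    rw [hnorm hA] at h
    have hlim : ∀ᶠ ε : ℝ in 𝓝[>] 0,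
        (C * (realGramian A (B * Bᵀ) + ε • realGramian A 1) * Cᵀ).trace < γ ^ 2 := by
      have : Tendsto (fun ε : ℝ =>
          (C * (realGramian A (B * Bᵀ) + ε • realGramian A 1) * Cᵀ).trace) (𝓝 0)
          (𝓝 ((C * (realGramian A (B * Bᵀ) + (0 : ℝ) • realGramian A 1) * Cᵀ).trace)) :=
        Continuous.tendsto (by fun_prop) 0
      rw [zero_smul, add_zero] at this
      exact (this.eventually_lt_const h).filter_mono nhdsWithin_le_nhds
    obtain ⟨ε, hε, hε0⟩ := (hlim.and self_mem_nhdsWithin).exists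
    refine ⟨rfl, _, ((realGramian_one_posDef hA).smul hε0).posSemidef_add
      (realGramian_posSemidef hA hBB), ?_, hε⟩
    have e : -(A * (realGramian A (B * Bᵀ) + ε • realGramian A 1) +
        (realGramian A (B * Bᵀ) + ε • realGramian A 1) * Aᵀ + B * Bᵀ) =
        ε • (1 : Matrix n n ℝ) := by
      have h1 := lyapunov_realGramian hA (B * Bᵀ)
      have h2 := lyapunov_realGramian hA 1
      calc _ = -((A * realGramian A (B * Bᵀ) + realGramian A (B * Bᵀ) * Aᵀ) +
          ε • (A * realGramian A 1 + realGramian A 1 * Aᵀ) + B * Bᵀ) := by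
            simp only [mul_add, add_mul, mul_smul_comm, smul_mul_assoc, smul_add]
            abel
        _ = _ := by
            rw [h1, h2, smul_neg]
            abel
    rw [e]
    exact PosDef.one.smul hε0
  · rintro ⟨rfl, P, hP, hL, ht⟩
    have hA := isHurwitz_of_lyapunov hP hBB hL
    refine ⟨hA, (hnorm hA).mpr (lt_of_le_of_lt ?_ ht)⟩
    -- `V` is the slack of the inequality. By uniqueness `P` exceeds the Gramian of `B Bᵀ` by the
    -- Gramian of `V`, which is positive semidefinite, so the trace only decreases.
    set V := -(A * P + P * Aᵀ + B * Bᵀ) with hV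
    have h1 := lyapunov_realGramian hA V
    have h2 : realGramian A (B * Bᵀ) = P - realGramian A V := by
      refine realGramian_of_lyapunov hA ?_
      calc _ = (A * P + P * Aᵀ) - (A * realGramian A V + realGramian A V * Aᵀ) := by
            simp only [mul_sub, sub_mul]
            abel
        _ = _ := by
            rw [h1, hV]
            abel
    rw [h2, Matrix.mul_sub, Matrix.sub_mul, trace_sub]
    have h3 := ((realGramian_posSemidef hA hL.posSemidef).mul_mul_conjTranspose_same C).trace_nonneg
    rw [conjTranspose_eq_transpose_of_trivial] at h3
    linarith

end Gramian

/-! ### Block matrices used as congruence factors -/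

section Blocks

variable {m n l : Type*}

theorem posDef_fromBlocks_diagonal_iff [Fintype m] [Fintype n] {A : Matrix m m ℝ}
    {D : Matrix n n ℝ} : (fromBlocks A 0 0 D).PosDef ↔ A.PosDef ∧ D.PosDef := by
  constructor
  · intro h
    exact ⟨h.submatrix (e := Sum.inl) Sum.inl_injective,
      h.submatrix (e := Sum.inr) Sum.inr_injective⟩
  · rintro ⟨hA, hD⟩
    refine PosDef.of_dotProduct_mulVec_pos
      (hA.isHermitian.fromBlocks (by simp) hD.isHermitian) fun v hv => ?_
    obtain ⟨a, b, rfl⟩ : ∃ a b, v = Sum.elim a b := ⟨v ∘ Sum.inl, v ∘ Sum.inr, by simp⟩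
    simp only [star_trivial, fromBlocks_mulVec, Sum.elim_comp_inl, Sum.elim_comp_inr, zero_mulVec,
      add_zero, zero_add, sumElim_dotProduct_sumElim]
    have ha := hA.posSemidef.dotProduct_mulVec_nonneg a
    have hd := hD.posSemidef.dotProduct_mulVec_nonneg b
    rw [star_trivial] at ha hd
    by_cases h : a = 0
    · have hb : b ≠ 0 := by
        rintro rfl
        apply hv
        rw [h]
        ext (i | i) <;> rfl
      have := hD.dotProduct_mulVec_pos hb
      rw [star_trivial] at this
      linarith
    · have := hA.dotProduct_mulVec_pos h
      rw [star_trivial] at this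
      linarith

/-- The block lower triangular matrix `[U 0; G I]`. -/
def lowerBlock [DecidableEq n] (U : Matrix l m ℝ) (G : Matrix n m ℝ) :
    Matrix (l ⊕ n) (m ⊕ n) ℝ :=
  fromBlocks U 0 G 1

/-- The block upper triangular matrix `[U G; 0 I]`. -/
def upperBlock [DecidableEq n] (U : Matrix l m ℝ) (G : Matrix l n ℝ) :
    Matrix (l ⊕ n) (m ⊕ n) ℝ :=
  fromBlocks U G 0 1

theorem injective_lowerBlock [Fintype m] [Fintype n] [DecidableEq n]
    {U : Matrix l m ℝ} (hU : Function.Injective U.mulVec) (G : Matrix n m ℝ) :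
    Function.Injective (lowerBlock U G).mulVec := by
  intro a b h
  simp only [lowerBlock, fromBlocks_mulVec, zero_mulVec, add_zero, one_mulVec] at h
  have h1 := hU (funext fun i => congrFun h (Sum.inl i))
  have h2 : a ∘ Sum.inr = b ∘ Sum.inr := by
    funext i
    have := congrFun h (Sum.inr i)
    simpa [h1] using this
  ext (i | i)
  · exact congrFun h1 i
  · exact congrFun h2 i

theorem injective_upperBlock [Fintype m] [Fintype n] [DecidableEq n]
    {U : Matrix l m ℝ} (hU : Function.Injective U.mulVec) (G : Matrix l n ℝ) :
    Function.Injective (upperBlock U G).mulVec := by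
  intro a b h
  simp only [upperBlock, fromBlocks_mulVec, zero_mulVec, zero_add, one_mulVec] at h
  have h2 : a ∘ Sum.inr = b ∘ Sum.inr := funext fun i => congrFun h (Sum.inr i)
  have h1 : a ∘ Sum.inl = b ∘ Sum.inl := by
    refine hU (funext fun i => ?_)
    have := congrFun h (Sum.inl i)
    simpa [h2] using this
  ext (i | i)
  · exact congrFun h1 i
  · exact congrFun h2 i

theorem injective_transpose_of_isUnit [Fintype n] [DecidableEq n] {M : Matrix n n ℝ}
    (hM : IsUnit M) : Function.Injective Mᵀ.mulVec :=
  mulVec_injective_iff_isUnit.mpr (by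
    rw [isUnit_iff_isUnit_det] at hM ⊢
    rwa [det_transpose])

end Blocks

/-! ### Linearising congruence between certificates and matrix inequalities -/

section Congruence

variable {x u w z y k : Type*} [Fintype x] [Fintype u] [Fintype w] [Fintype z] [Fintype y]
  [Fintype k] [DecidableEq x] [DecidableEq w] [DecidableEq k]

/-- The congruence factor `[X I; Mᵀ 0]`. -/
def factor₁ (X : Matrix x x ℝ) (M : Matrix x k ℝ) : Matrix (x ⊕ k) (x ⊕ x) ℝ :=
  fromBlocks X 1 Mᵀ 0

/-- The congruence factor `[I Y; 0 Nᵀ]`. -/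
def factor₂ (Y : Matrix x x ℝ) (N : Matrix x k ℝ) : Matrix (x ⊕ k) (x ⊕ x) ℝ :=
  fromBlocks 1 Y 0 Nᵀ

omit [Fintype k] [DecidableEq k] in
theorem injective_factor₁ (X : Matrix x x ℝ) {M : Matrix x k ℝ}
    (hM : Function.Injective Mᵀ.mulVec) : Function.Injective (factor₁ X M).mulVec := by
  intro a b h
  simp only [factor₁, fromBlocks_mulVec, zero_mulVec, add_zero, one_mulVec] at h
  have h1 : a ∘ Sum.inl = b ∘ Sum.inl := hM (funext fun i => congrFun h (Sum.inr i))
  have h2 : a ∘ Sum.inr = b ∘ Sum.inr := by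
    funext i
    have := congrFun h (Sum.inl i)
    simpa [h1] using this
  ext (i | i)
  · exact congrFun h1 i
  · exact congrFun h2 i

/-- `X, Y, M, N` are the blocks of the positive definite `X_cl` and of its inverse `P`. -/
structure LyapunovBlocks (P : Matrix (x ⊕ k) (x ⊕ k) ℝ) (X Y : Matrix x x ℝ)
    (M N : Matrix x k ℝ) : Prop where
  symm : Pᵀ = P
  symmX : Xᵀ = X
  symmY : Yᵀ = Y
  mul_factor : P * factor₂ Y N = factor₁ X M
  factor_mul : (factor₂ Y N)ᵀ * factor₁ X M = fromBlocks X 1 1 Y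

theorem transpose_eq_of_posDef {n : Type*} {P : Matrix n n ℝ} (hP : P.PosDef) : Pᵀ = P := by
  rw [← conjTranspose_eq_transpose_of_trivial]
  exact hP.isHermitian

/-- These are the two blocks in the first block column of `X_cl⁻¹ X_cl = 1`. -/
theorem IsPartition.inv_mul_blocks {Xcl : Matrix (x ⊕ k) (x ⊕ k) ℝ} {X Y : Matrix x x ℝ}
    {M N : Matrix x k ℝ} (hX : Xcl.PosDef) (h : IsPartition Xcl X Y M N) :
    X * Y + M * Nᵀ = 1 ∧ Mᵀ * Y + Xcl⁻¹.toBlocks₂₂ * Nᵀ = 0 := by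
  obtain ⟨h1, h2, h3, h4, h5, h6⟩ := h
  have e : Xcl⁻¹ * Xcl = 1 := nonsing_inv_mul _ ((isUnit_iff_isUnit_det _).mp hX.isUnit)
  have a1 := fromBlocks_toBlocks Xcl⁻¹
  have a2 := fromBlocks_toBlocks Xcl
  rw [h4, h5, h6] at a1
  rw [h1, h2, h3] at a2
  generalize Xcl⁻¹.toBlocks₂₂ = P₂ at a1 ⊢
  rw [← a1, ← a2, fromBlocks_multiply, ← fromBlocks_one, fromBlocks_inj] at e
  exact ⟨e.1, e.2.2.1⟩

theorem IsPartition.lyapunovBlocks {Xcl : Matrix (x ⊕ k) (x ⊕ k) ℝ} {X Y : Matrix x x ℝ}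
    {M N : Matrix x k ℝ} (hX : Xcl.PosDef) (h : IsPartition Xcl X Y M N) :
    LyapunovBlocks Xcl⁻¹ X Y M N := by
  obtain ⟨e1, e2⟩ := h.inv_mul_blocks hX
  obtain ⟨h1, h2, h3, h4, h5, h6⟩ := h
  have sX : Xᵀ = X := by
    have := transpose_eq_of_posDef hX.inv
    rw [← h4]
    ext i j
    exact congrFun (congrFun this (Sum.inl i)) (Sum.inl j)
  have sY : Yᵀ = Y := by
    have := transpose_eq_of_posDef hX
    rw [← h1]
    ext i j
    exact congrFun (congrFun this (Sum.inl i)) (Sum.inl j)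
  refine ⟨transpose_eq_of_posDef hX.inv, sX, sY, ?_, ?_⟩
  · rw [← fromBlocks_toBlocks Xcl⁻¹, factor₁, factor₂, h4, h5, h6, fromBlocks_multiply, e1, e2]
    simp
  · have e3 : Y * X + N * Mᵀ = 1 := by
      have := congrArg transpose e1
      simpa [sX, sY] using this
    rw [factor₁, factor₂, fromBlocks_transpose, fromBlocks_multiply]
    simp [sY, e3]

variable {S : Plant x u w z y} {J : Controller k u y} {P : Matrix (x ⊕ k) (x ⊕ k) ℝ}
  {X Y : Matrix x x ℝ} {M N : Matrix x k ℝ}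

omit [DecidableEq k] in
-- `P Π₂ = Π₁` and `Π₁` is injective; no condition on `N` is needed.
theorem LyapunovBlocks.injective_factor₂ (h : LyapunovBlocks P X Y M N)
    (hM : Function.Injective Mᵀ.mulVec) : Function.Injective (factor₂ Y N).mulVec := by
  refine Function.Injective.of_comp (f := P.mulVec) ?_
  have : P.mulVec ∘ (factor₂ Y N).mulVec = (factor₁ X M).mulVec := by
    funext v
    simp [← h.mul_factor, mulVec_mulVec]
  rw [this]
  exact injective_factor₁ X hM

omit [Fintype w] [Fintype z] [DecidableEq w] [DecidableEq k] in
-- This identity is the purpose of the change of variables: every product of controller blocks with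
-- `X, Y, M, N` is absorbed in `Ĵ`, and what remains is affine in `(Ĵ, X, Y)`.
theorem factor₂_mul_Acl_mul_factor₁ (S : Plant x u w z y) (J : Controller k u y)
    (X : Matrix x x ℝ) (M N : Matrix x k ℝ) (hY : Yᵀ = Y) :
    (factor₂ Y N)ᵀ * Acl S J * factor₁ X M =
      fromBlocks (S.A * X + S.Bu * (hat S J X Y M N).toBlocks₂₁)
        (S.A + S.Bu * (hat S J X Y M N).toBlocks₂₂ * S.Cy) (hat S J X Y M N).toBlocks₁₁
        (Y * S.A + (hat S J X Y M N).toBlocks₁₂ * S.Cy) := by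
  rw [factor₁, factor₂, Acl, fromBlocks_transpose, fromBlocks_multiply, fromBlocks_multiply]
  simp only [hat, toBlocks_fromBlocks₁₁, toBlocks_fromBlocks₁₂, toBlocks_fromBlocks₂₁,
    toBlocks_fromBlocks₂₂, hY, transpose_one, transpose_zero, transpose_transpose, Matrix.one_mul,
    Matrix.zero_mul, Matrix.mul_zero, Matrix.mul_one, add_zero]
  congr 1
  · simp only [Matrix.mul_add, Matrix.add_mul, Matrix.mul_assoc]
    abel
  · simp only [Matrix.mul_add, Matrix.add_mul, Matrix.mul_assoc]
    abel
  · simp only [Matrix.mul_add, Matrix.add_mul, Matrix.mul_assoc]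
    abel

omit [Fintype w] [Fintype z] [DecidableEq w] [DecidableEq k] in
theorem factor₂_mul_Bcl (S : Plant x u w z y) (J : Controller k u y)
    (X : Matrix x x ℝ) (M N : Matrix x k ℝ) (hY : Yᵀ = Y) :
    (factor₂ Y N)ᵀ * Bcl S J =
      fromRows (S.Bw + S.Bu * (hat S J X Y M N).toBlocks₂₂ * S.Dyw)
        (Y * S.Bw + (hat S J X Y M N).toBlocks₁₂ * S.Dyw) := by
  rw [factor₂, Bcl, fromBlocks_transpose, fromBlocks_mul_fromRows]
  simp only [hat, toBlocks_fromBlocks₁₂, toBlocks_fromBlocks₂₂, hY, transpose_one, transpose_zero,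
    transpose_transpose, Matrix.one_mul, Matrix.zero_mul, add_zero]
  congr 1
  simp only [Matrix.mul_add, Matrix.add_mul, Matrix.mul_assoc]
  abel

omit [Fintype w] [Fintype z] [DecidableEq w] [DecidableEq k] in
theorem Ccl_mul_factor₁ (S : Plant x u w z y) (J : Controller k u y)
    (X Y : Matrix x x ℝ) (M N : Matrix x k ℝ) :
    Ccl S J * factor₁ X M =
      fromCols (S.Cz * X + S.Du * (hat S J X Y M N).toBlocks₂₁)
        (S.Cz + S.Du * (hat S J X Y M N).toBlocks₂₂ * S.Cy) := by
  rw [factor₁, Ccl, fromCols_mul_fromBlocks]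
  simp only [hat, toBlocks_fromBlocks₂₁, toBlocks_fromBlocks₂₂, Matrix.mul_one, Matrix.mul_zero,
    add_zero]
  congr 1
  simp only [Matrix.mul_add, Matrix.add_mul, Matrix.mul_assoc]
  abel

omit [Fintype z] [DecidableEq k] in
-- A Schur complement against the block `-I`, combined with congruence by `Π₂`. The `B Bᵀ` terms
-- cancel in the corner, and `P Π₂ = Π₁` removes `P`.
theorem neg_lmi₁_eq (S : Plant x u w z y) (J : Controller k u y)
    (h : LyapunovBlocks P X Y M N) :
    -(lmi₁ S (hat S J X Y M N) X Y) =
      (lowerBlock (factor₂ Y N) (-((factor₂ Y N)ᵀ * Bcl S J)ᵀ))ᵀ *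
        fromBlocks (-(Acl S J * P + P * (Acl S J)ᵀ + Bcl S J * (Bcl S J)ᵀ)) 0 0 (1 : Matrix w w ℝ) *
        lowerBlock (factor₂ Y N) (-((factor₂ Y N)ᵀ * Bcl S J)ᵀ) := by
  have hK := factor₂_mul_Acl_mul_factor₁ S J X M N h.symmY
  have hF := factor₂_mul_Bcl S J X M N h.symmY
  have e : lmi₁ S (hat S J X Y M N) X Y =
      fromBlocks ((factor₂ Y N)ᵀ * Acl S J * factor₁ X M +
        ((factor₂ Y N)ᵀ * Acl S J * factor₁ X M)ᵀ)
        ((factor₂ Y N)ᵀ * Bcl S J) ((factor₂ Y N)ᵀ * Bcl S J)ᵀ (-1) := by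
    rw [hK, hF, lmi₁]
    simp only [transpose_fromRows, fromBlocks_transpose, fromBlocks_add, sym]
    congr 2
    · simp [add_comm]
  have hP := h.symm
  rw [e, lowerBlock, fromBlocks_neg, fromBlocks_transpose, fromBlocks_multiply, fromBlocks_multiply,
    ← h.mul_factor]
  congr 1
  · simp only [transpose_neg, transpose_mul, transpose_transpose, Matrix.mul_add, Matrix.add_mul,
      Matrix.mul_neg, Matrix.neg_mul, Matrix.mul_zero, Matrix.mul_one, Matrix.mul_assoc,
      hP, neg_neg, zero_add, add_zero, neg_add]
    abel
  · simp
  · simp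
  · simp

omit [Fintype w] [DecidableEq w] [DecidableEq k] in
-- A Schur complement against the block `P`: the trace bound becomes `Q > C P Cᵀ` with `tr Q < γ₀²`.
theorem lmi₂_eq (S : Plant x u w z y) (J : Controller k u y) [DecidableEq z]
    (h : LyapunovBlocks P X Y M N) (Q : Matrix z z ℝ) :
    lmi₂ S (hat S J X Y M N) X Y Q =
      (upperBlock (factor₂ Y N) (Ccl S J)ᵀ)ᵀ *
        fromBlocks P 0 0 (Q - Ccl S J * P * (Ccl S J)ᵀ) *
        upperBlock (factor₂ Y N) (Ccl S J)ᵀ := by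
  have hH := Ccl_mul_factor₁ S J X Y M N
  have e : lmi₂ S (hat S J X Y M N) X Y Q =
      fromBlocks ((factor₂ Y N)ᵀ * factor₁ X M) (Ccl S J * factor₁ X M)ᵀ
        (Ccl S J * factor₁ X M) Q := by
    rw [hH, h.factor_mul, lmi₂]
    simp only [transpose_fromCols]
  rw [e, upperBlock, fromBlocks_transpose, fromBlocks_multiply, fromBlocks_multiply, ← h.mul_factor]
  congr 1 <;> simp [Matrix.mul_assoc, h.symm]

omit [DecidableEq w] in
theorem meetsH2Spec_iff {γ₀ : ℝ} (hγ₀ : 0 < γ₀) :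
    MeetsH2Spec S γ₀ J ↔ Dcl S J = 0 ∧
      ∃ P, IsH2Certificate (Acl S J) (Bcl S J) (Ccl S J) γ₀ P :=
  stable_h2Norm_lt_iff _ _ _ _ hγ₀

omit [DecidableEq k] in
-- The controller order is arbitrary: congruence by an injective, possibly non-square, factor still
-- preserves positive definiteness.
theorem mem_lmiFeasible_of_certificate [DecidableEq z] {γ₀ : ℝ} (h : LyapunovBlocks P X Y M N)
    (hM : Function.Injective Mᵀ.mulVec) (hD : Dcl S J = 0)
    (hc : IsH2Certificate (Acl S J) (Bcl S J) (Ccl S J) γ₀ P) :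
    ∃ Q, (hat S J X Y M N, X, Y, Q) ∈ lmiFeasible S γ₀ := by
  obtain ⟨hP, hL, ht⟩ := hc
  have hinj := h.injective_factor₂ hM
  -- `Q = C P Cᵀ + ε I` must keep its trace below `γ₀²`. Dividing the gap by the number of outputs
  -- plus one keeps this strict and covers the case of no outputs.
  obtain ⟨ε, hε, hε0⟩ : ∃ ε : ℝ, (Ccl S J * P * (Ccl S J)ᵀ).trace + ε * Fintype.card z < γ₀ ^ 2 ∧
      0 < ε := by
    refine ⟨(γ₀ ^ 2 - (Ccl S J * P * (Ccl S J)ᵀ).trace) / (Fintype.card z + 1), ?_, ?_⟩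
    · have h1 : 0 < γ₀ ^ 2 - (Ccl S J * P * (Ccl S J)ᵀ).trace := sub_pos.mpr ht
      have h2 : (Fintype.card z : ℝ) / (Fintype.card z + 1) < 1 := by
        rw [div_lt_one (by positivity)]
        linarith
      have h3 := mul_lt_mul_of_pos_left h2 h1
      rw [div_mul_eq_mul_div, ← mul_div_assoc']
      linarith
    · exact div_pos (sub_pos.mpr ht) (by positivity)
  refine ⟨Ccl S J * P * (Ccl S J)ᵀ + ε • 1, ?_, ?_, ?_, ?_⟩
  · change (-(lmi₁ S (hat S J X Y M N) X Y)).PosDef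
    rw [neg_lmi₁_eq S J h, ← conjTranspose_eq_transpose_of_trivial (lowerBlock (factor₂ Y N) _)]
    exact (posDef_fromBlocks_diagonal_iff.mpr ⟨hL, PosDef.one (n := w)⟩).conjTranspose_mul_mul_same
      (injective_lowerBlock hinj _)
  · change (lmi₂ S (hat S J X Y M N) X Y _).PosDef
    rw [lmi₂_eq S J h, ← conjTranspose_eq_transpose_of_trivial (upperBlock (factor₂ Y N) _),
      add_sub_cancel_left]
    exact (posDef_fromBlocks_diagonal_iff.mpr
      ⟨hP, (PosDef.one (n := z)).smul hε0⟩).conjTranspose_mul_mul_same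
      (injective_upperBlock hinj _)
  · change Matrix.trace (_ + _) < _
    simpa [trace_add, trace_smul] using hε
  · simpa [hat, Dcl] using hD

/-- At full order the factors are square and invertible, so the congruences can be undone. -/
theorem certificate_of_mem_lmiFeasible [DecidableEq z] {γ₀ : ℝ} {J : Controller x u y}
    {P : Matrix (x ⊕ x) (x ⊕ x) ℝ} {M N : Matrix x x ℝ} {Q : Matrix z z ℝ}
    (h : LyapunovBlocks P X Y M N) (hM : IsUnit M)
    (hl : (hat S J X Y M N, X, Y, Q) ∈ lmiFeasible S γ₀) :
    Dcl S J = 0 ∧ IsH2Certificate (Acl S J) (Bcl S J) (Ccl S J) γ₀ P := by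
  obtain ⟨h1, h2, h3, h4⟩ := hl
  have hinj := h.injective_factor₂ (injective_transpose_of_isUnit hM)
  change (-(lmi₁ S (hat S J X Y M N) X Y)).PosDef at h1
  change (lmi₂ S (hat S J X Y M N) X Y Q).PosDef at h2
  rw [neg_lmi₁_eq S J h, ← conjTranspose_eq_transpose_of_trivial (lowerBlock (factor₂ Y N) _),
    ← star_eq_conjTranspose, IsUnit.posDef_star_left_conjugate_iff
      (mulVec_injective_iff_isUnit.mp (injective_lowerBlock hinj _)),
    posDef_fromBlocks_diagonal_iff] at h1
  rw [lmi₂_eq S J h, ← conjTranspose_eq_transpose_of_trivial (upperBlock (factor₂ Y N) _),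
    ← star_eq_conjTranspose, IsUnit.posDef_star_left_conjugate_iff
      (mulVec_injective_iff_isUnit.mp (injective_upperBlock hinj _)),
    posDef_fromBlocks_diagonal_iff] at h2
  refine ⟨by simpa [hat, Dcl] using h4, h2.1, h1.1, ?_⟩
  have := h2.2.posSemidef.trace_nonneg
  rw [trace_sub] at this
  change Q.trace < _ at h3
  linarith

end Congruence

/-! ### Perturbing a certificate to a nonsingular off-diagonal block -/

section Perturbation

variable {n w z x k : Type*} [Fintype n] [DecidableEq n] [Fintype w] [Fintype z]
  [Fintype x] [DecidableEq x] [Fintype k] [DecidableEq k]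

/-- Failure means that `t` is an eigenvalue of `-M`. There are finitely many, so small `t > 0`
avoids them. -/
theorem isUnit_add_smul_one_eventually (M : Matrix n n ℝ) :
    ∀ᶠ t : ℝ in 𝓝[>] 0, IsUnit (M + t • (1 : Matrix n n ℝ)) := by
  have hfin : (spectrum ℝ (-M) \ {0}).Finite := (finite_real_spectrum (A := -M)).sdiff
  have h0 : ∀ᶠ t : ℝ in 𝓝 0, t ∉ spectrum ℝ (-M) \ {0} :=
    hfin.isClosed.isOpen_compl.mem_nhds (by simp)
  filter_upwards [h0.filter_mono nhdsWithin_le_nhds, self_mem_nhdsWithin] with t ht ht0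
  have h1 : t ∉ spectrum ℝ (-M) := fun h => ht ⟨h, ne_of_gt ht0⟩
  rw [spectrum.notMem_iff, Algebra.algebraMap_eq_smul_one, sub_neg_eq_add, add_comm] at h1
  exact h1

/-- Adding `t [0 I; I 0]` shifts the off-diagonal block by `t I` and keeps the certificate for small
`t`. -/
theorem IsH2Certificate.exists_isUnit_toBlocks₁₂ {A : Matrix (x ⊕ x) (x ⊕ x) ℝ}
    {B : Matrix (x ⊕ x) w ℝ} {C : Matrix z (x ⊕ x) ℝ} {γ : ℝ} {P : Matrix (x ⊕ x) (x ⊕ x) ℝ}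
    (h : IsH2Certificate A B C γ P) :
    ∃ P', IsH2Certificate A B C γ P' ∧ IsUnit P'.toBlocks₁₂ := by
  have hE : (fromBlocks 0 1 1 0 : Matrix (x ⊕ x) (x ⊕ x) ℝ).IsHermitian :=
    isHermitian_zero.fromBlocks (by simp) isHermitian_zero
  obtain ⟨t, h1, h2⟩ := (((h.add_smul_eventually hE).filter_mono nhdsWithin_le_nhds).and
    (isUnit_add_smul_one_eventually P.toBlocks₁₂)).exists
  exact ⟨_, h1, h2⟩

theorem isPartition_of_posDef {P : Matrix (x ⊕ k) (x ⊕ k) ℝ} (hP : P.PosDef) :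
    IsPartition P⁻¹ P.toBlocks₁₁ P⁻¹.toBlocks₁₁ P.toBlocks₁₂ P⁻¹.toBlocks₁₂ := by
  have e : P⁻¹⁻¹ = P := nonsing_inv_nonsing_inv _ ((isUnit_iff_isUnit_det _).mp hP.isUnit)
  have h1 := transpose_eq_of_posDef hP
  have h2 := transpose_eq_of_posDef hP.inv
  refine ⟨rfl, rfl, ?_, by rw [e], by rw [e], ?_⟩
  · ext i j
    exact (congrFun (congrFun h2 (Sum.inr i)) (Sum.inl j)).symm
  · rw [e]
    ext i j
    exact (congrFun (congrFun h1 (Sum.inr i)) (Sum.inl j)).symm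

/-- The `(2,1)` block of `X_cl⁻¹ X_cl = 1` gives `P₂₂ Nᵀ = -Mᵀ Y`, and `Y` is positive definite. -/
theorem IsPartition.isUnit_right {Xcl : Matrix (x ⊕ x) (x ⊕ x) ℝ} {X Y M N : Matrix x x ℝ}
    (hX : Xcl.PosDef) (h : IsPartition Xcl X Y M N) (hM : IsUnit M) : IsUnit N := by
  have h1 := (h.inv_mul_blocks hX).2
  have hY : Y.PosDef := by
    rw [← h.1]
    exact hX.submatrix Sum.inl_injective
  have h2 : IsUnit (Xcl⁻¹.toBlocks₂₂ * Nᵀ) := by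
    rw [eq_neg_of_add_eq_zero_right h1]
    refine (IsUnit.mul ?_ hY.isUnit).neg
    rw [isUnit_iff_isUnit_det] at hM ⊢
    rwa [det_transpose]
  rw [isUnit_iff_isUnit_det, det_mul, det_transpose] at h2
  rw [isUnit_iff_isUnit_det]
  exact isUnit_of_mul_isUnit_right h2

end Perturbation

/-! ### Reconstruction of a full-order controller -/

section Construction

variable {x u w z y : Type*} [Fintype x] [Fintype u] [Fintype w] [Fintype z] [Fintype y]
  [DecidableEq x] [DecidableEq w] [DecidableEq z] {S : Plant x u w z y} {γ₀ : ℝ}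
  {Jh : Matrix (x ⊕ u) (x ⊕ y) ℝ} {X Y M N : Matrix x x ℝ} {Q : Matrix z z ℝ}

omit [DecidableEq w] [Fintype w] [Fintype z] [DecidableEq z] in
theorem hat_construct (hM : IsUnit M) (hN : IsUnit N) :
    hat S (construct S Jh X Y M N) X Y M N = Jh := by
  have hMt : IsUnit Mᵀ.det := by
    rw [det_transpose]
    exact (isUnit_iff_isUnit_det M).mp hM
  have hNd := (isUnit_iff_isUnit_det N).mp hN
  rw [hat]
  conv_rhs => rw [← fromBlocks_toBlocks Jh]
  simp only [construct, toBlocks_fromBlocks₁₁, toBlocks_fromBlocks₁₂, toBlocks_fromBlocks₂₁,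
    toBlocks_fromBlocks₂₂]
  congr 1
  · rw [Matrix.mul_assoc N⁻¹, mul_nonsing_inv_cancel_left _ _ hNd,
      nonsing_inv_mul_cancel_right _ _ hMt]
    abel
  · rw [mul_nonsing_inv_cancel_left _ _ hNd]
    abel
  · rw [nonsing_inv_mul_cancel_right _ _ hMt]
    abel

omit [Fintype w] [DecidableEq z] in
theorem posDef_of_mem_lmiFeasible (h : (Jh, X, Y, Q) ∈ lmiFeasible S γ₀) :
    (fromBlocks X 1 1 Y).PosDef :=
  h.2.1.submatrix (e := Sum.inl) Sum.inl_injective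

/-- If `v = X Y v`, then `(-Y v, v)` lies in the kernel of `[X I; I Y]`, so `v = 0`. -/
theorem isUnit_one_sub_mul (h : (fromBlocks X 1 1 Y).PosDef) :
    IsUnit (1 - X * Y) := by
  have hG := mulVec_injective_iff_isUnit.mpr h.isUnit
  rw [← mulVec_injective_iff_isUnit]
  refine (injective_iff_map_eq_zero (Matrix.mulVecLin (1 - X * Y))).mpr fun v hv => ?_
  rw [mulVecLin_apply, sub_mulVec, one_mulVec, sub_eq_zero, ← mulVec_mulVec] at hv
  have h1 : (fromBlocks X 1 1 Y) *ᵥ (Sum.elim (-(Y *ᵥ v)) v) = 0 := by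
    rw [fromBlocks_mulVec]
    simp only [Sum.elim_comp_inl, Sum.elim_comp_inr, mulVec_neg, one_mulVec, ← hv]
    ext (i | i) <;> simp
  have h2 := hG (h1.trans (mulVec_zero _).symm)
  funext i
  exact congrFun h2 (Sum.inr i)

/-- The requirement `X_cl Π₁ = Π₂` forces `X_cl = Π₁⁻ᵀ (Π₁ᵀ Π₂) Π₁⁻¹`, and `Π₁ᵀ Π₂ = [X I; I Y]`, so
`X_cl` is congruent to a positive definite matrix. -/
theorem exists_isPartition (h : (fromBlocks X 1 1 Y).PosDef) (hMN : M * Nᵀ = 1 - X * Y)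
    (hM : IsUnit M) :
    ∃ Xcl : Matrix (x ⊕ x) (x ⊕ x) ℝ, Xcl.PosDef ∧ IsPartition Xcl X Y M N := by
  have hX : Xᵀ = X := transpose_eq_of_posDef (h.submatrix (e := Sum.inl) Sum.inl_injective)
  have hMt := injective_transpose_of_isUnit hM
  have hu : IsUnit (factor₁ X M) := mulVec_injective_iff_isUnit.mp (injective_factor₁ X hMt)
  have hd := (isUnit_iff_isUnit_det _).mp hu
  have hdi : IsUnit (factor₁ X M)⁻¹ := (isUnit_iff_isUnit_det _).mpr (isUnit_nonsing_inv_det _ hd)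
  have hG : (factor₁ X M)ᵀ * factor₂ Y N = fromBlocks X 1 1 Y := by
    rw [factor₁, factor₂, fromBlocks_transpose, fromBlocks_multiply]
    simp [hMN, hX]
  have hXcl : (star (factor₁ X M)⁻¹ * fromBlocks X 1 1 Y * (factor₁ X M)⁻¹).PosDef :=
    (IsUnit.posDef_star_left_conjugate_iff hdi).mpr h
  set Xcl := star (factor₁ X M)⁻¹ * fromBlocks X 1 1 Y * (factor₁ X M)⁻¹ with hdef
  have e1 : Xcl * factor₁ X M = factor₂ Y N := by
    rw [hdef, Matrix.mul_assoc, nonsing_inv_mul _ hd, Matrix.mul_one, ← hG, ← Matrix.mul_assoc,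
      star_eq_conjTranspose, conjTranspose_eq_transpose_of_trivial, ← transpose_mul,
      mul_nonsing_inv _ hd, transpose_one, Matrix.one_mul]
  have e2 : Xcl⁻¹ * factor₂ Y N = factor₁ X M := by
    rw [← e1, ← Matrix.mul_assoc,
      nonsing_inv_mul _ ((isUnit_iff_isUnit_det _).mp hXcl.isUnit), Matrix.one_mul]
  have s1 := transpose_eq_of_posDef hXcl
  have s2 := transpose_eq_of_posDef hXcl.inv
  refine ⟨Xcl, hXcl, ?_⟩
  clear_value Xcl
  have b1 : Xcl.toBlocks₁₁ = Y ∧ Xcl.toBlocks₂₁ = Nᵀ := by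
    rw [← fromBlocks_toBlocks Xcl, factor₁, factor₂, fromBlocks_multiply, fromBlocks_inj] at e1
    simpa using And.intro e1.2.1 e1.2.2.2
  have b2 : Xcl⁻¹.toBlocks₁₁ = X ∧ Xcl⁻¹.toBlocks₂₁ = Mᵀ := by
    generalize Xcl⁻¹ = P at e2 ⊢
    rw [← fromBlocks_toBlocks P, factor₁, factor₂, fromBlocks_multiply, fromBlocks_inj] at e2
    simpa using And.intro e2.1 e2.2.2.1
  have c1 : Xcl.toBlocks₁₂ = (Xcl.toBlocks₂₁)ᵀ := by
    ext i j
    exact (congrFun (congrFun s1 (Sum.inl i)) (Sum.inr j)).symm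
  have c2 : Xcl⁻¹.toBlocks₁₂ = (Xcl⁻¹.toBlocks₂₁)ᵀ := by
    ext i j
    exact (congrFun (congrFun s2 (Sum.inl i)) (Sum.inr j)).symm
  exact ⟨b1.1, by rw [c1, b1.2, transpose_transpose], b1.2, b2.1,
    by rw [c2, b2.2, transpose_transpose], b2.2⟩

theorem represents_construct (hγ₀ : 0 < γ₀) (h : (Jh, X, Y, Q) ∈ lmiFeasible S γ₀)
    (hMN : M * Nᵀ = 1 - X * Y) :
    Represents S γ₀ (construct S Jh X Y M N) X Y M N Jh := by
  have hG := posDef_of_mem_lmiFeasible h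
  have hu := isUnit_one_sub_mul hG
  rw [← hMN, isUnit_iff_isUnit_det, det_mul, det_transpose] at hu
  have hM : IsUnit M := (isUnit_iff_isUnit_det _).mpr (isUnit_of_mul_isUnit_left hu)
  have hN : IsUnit N := (isUnit_iff_isUnit_det _).mpr (isUnit_of_mul_isUnit_right hu)
  obtain ⟨Xcl, hX, hp⟩ := exists_isPartition hG hMN hM
  have hJ := hat_construct (S := S) (Jh := Jh) (X := X) (Y := Y) hM hN
  have hc := certificate_of_mem_lmiFeasible (J := construct S Jh X Y M N)
    (hp.lyapunovBlocks hX) hM (by rwa [hJ])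
  exact ⟨(meetsH2Spec_iff hγ₀).mpr ⟨hc.1, _, hc.2⟩, ⟨Xcl, ⟨hX, hc.2.2⟩, hp⟩, hM, hN, hJ.symm⟩

theorem designFeasible_eq (hγ₀ : 0 < γ₀) :
    designFeasible S γ₀ = Prod.fst '' lmiFeasible S γ₀ := by
  ext Jh
  constructor
  · rintro ⟨J, X, Y, M, N, hs, ⟨Xcl, hc, hp⟩, hM, -, rfl⟩
    obtain ⟨Q, hQ⟩ := mem_lmiFeasible_of_certificate (hp.lyapunovBlocks hc.1)
      (injective_transpose_of_isUnit hM) ((meetsH2Spec_iff hγ₀).mp hs).1 ⟨hc.1.inv, hc.2⟩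
    exact ⟨_, hQ, rfl⟩
  · rintro ⟨⟨Jh, X, Y, Q⟩, h, rfl⟩
    -- Any factorisation of `I - XY` serves; `M = I - XY`, `N = I` is the simplest.
    exact ⟨_, X, Y, 1 - X * Y, 1, represents_construct hγ₀ h (by simp)⟩

theorem meetsH2Spec_iff_exists_mem_lmiFeasible (hγ₀ : 0 < γ₀) (J : Controller x u y) :
    MeetsH2Spec S γ₀ J ↔ ∃ Xcl X Y M N Q, Xcl.PosDef ∧ IsPartition Xcl X Y M N ∧ IsUnit M ∧
      IsUnit N ∧ (hat S J X Y M N, X, Y, Q) ∈ lmiFeasible S γ₀ := by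
  rw [meetsH2Spec_iff hγ₀]
  constructor
  · rintro ⟨hD, P₀, hP₀⟩
    obtain ⟨P, hP, hM⟩ := hP₀.exists_isUnit_toBlocks₁₂
    have hp := isPartition_of_posDef hP.1
    have hl := hp.lyapunovBlocks hP.1.inv
    rw [nonsing_inv_nonsing_inv _ ((isUnit_iff_isUnit_det _).mp hP.1.isUnit)] at hl
    obtain ⟨Q, hQ⟩ := mem_lmiFeasible_of_certificate hl (injective_transpose_of_isUnit hM) hD hP
    exact ⟨_, _, _, _, _, Q, hP.1.inv, hp, hM, hp.isUnit_right hP.1.inv hM, hQ⟩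
  · rintro ⟨Xcl, X, Y, M, N, Q, hX, hp, hM, -, hQ⟩
    obtain ⟨hD, hc⟩ := certificate_of_mem_lmiFeasible (hp.lyapunovBlocks hX) hM hQ
    exact ⟨hD, _, hc⟩

end Construction

/-! ### Controllers of arbitrary order -/

section Padding

variable {x u w z y k n m : Type*} [Fintype x] [Fintype u] [Fintype w] [Fintype z] [Fintype y]
  [Fintype k] [DecidableEq x] [DecidableEq w] [DecidableEq z] [DecidableEq k]
  [Fintype n] [DecidableEq n] [Fintype m] [DecidableEq m]

/-- The controller `J` with additional decoupled stable states. -/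
def padController (m : Type*) [DecidableEq m] (J : Controller k u y) : Controller (k ⊕ m) u y :=
  fromBlocks (fromBlocks J.toBlocks₁₁ 0 0 (-1)) (fromRows J.toBlocks₁₂ 0)
    (fromCols J.toBlocks₂₁ 0) J.toBlocks₂₂

omit [DecidableEq w] [DecidableEq z] [DecidableEq n] in
theorem IsH2Certificate.pad {A : Matrix n n ℝ} {B : Matrix n w ℝ} {C : Matrix z n ℝ} {γ : ℝ}
    {P : Matrix n n ℝ} (h : IsH2Certificate A B C γ P) :
    IsH2Certificate (fromBlocks A 0 0 (-1 : Matrix m m ℝ)) (fromRows B 0) (fromCols C 0) γ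
      (fromBlocks P 0 0 1) := by
  obtain ⟨h1, h2, h3⟩ := h
  refine ⟨posDef_fromBlocks_diagonal_iff.mpr ⟨h1, PosDef.one⟩, ?_, ?_⟩
  · have e : -(fromBlocks A 0 0 (-1 : Matrix m m ℝ) * fromBlocks P 0 0 1 +
        fromBlocks P 0 0 1 * (fromBlocks A 0 0 (-1 : Matrix m m ℝ))ᵀ +
        fromRows B 0 * (fromRows B 0)ᵀ) =
        fromBlocks (-(A * P + P * Aᵀ + B * Bᵀ)) 0 0 (1 + 1 : Matrix m m ℝ) := by
      rw [transpose_fromRows, fromRows_mul_fromCols, fromBlocks_transpose, fromBlocks_multiply,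
        fromBlocks_multiply, fromBlocks_add, fromBlocks_add, fromBlocks_neg]
      congr 1 <;> simp
    rw [e]
    exact posDef_fromBlocks_diagonal_iff.mpr ⟨h2, PosDef.one.add PosDef.one⟩
  · rw [fromCols_mul_fromBlocks, transpose_fromCols, fromCols_mul_fromRows]
    simpa using h3

omit [DecidableEq w] [DecidableEq z] [DecidableEq n] [DecidableEq m] in
theorem IsH2Certificate.submatrix {A : Matrix n n ℝ} {B : Matrix n w ℝ} {C : Matrix z n ℝ} {γ : ℝ}
    {P : Matrix n n ℝ} (h : IsH2Certificate A B C γ P) (e : m ≃ n) :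
    IsH2Certificate (A.submatrix e e) (B.submatrix e id) (C.submatrix id e) γ
      (P.submatrix e e) := by
  obtain ⟨h1, h2, h3⟩ := h
  refine ⟨h1.submatrix e.injective, ?_, ?_⟩
  · have := h2.submatrix e.injective
    convert this using 1
    rw [transpose_submatrix, transpose_submatrix, submatrix_mul_equiv, submatrix_mul_equiv,
      ← submatrix_mul _ _ _ _ _ Function.bijective_id]
    rfl
  · rwa [transpose_submatrix, submatrix_mul_equiv, submatrix_mul_equiv, submatrix_id_id]

omit [DecidableEq x] [DecidableEq w] [DecidableEq z] [DecidableEq k] in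
-- Padding the closed loop gives the index `(x ⊕ k) ⊕ m`, whereas padding the controller gives `x ⊕
-- (k ⊕ m)`; hence the reassociation.
theorem IsH2Certificate.padController {S : Plant x u w z y} {J : Controller k u y} {γ : ℝ}
    {P : Matrix (x ⊕ k) (x ⊕ k) ℝ} (h : IsH2Certificate (Acl S J) (Bcl S J) (Ccl S J) γ P) :
    IsH2Certificate (Acl S (padController m J)) (Bcl S (padController m J))
      (Ccl S (padController m J)) γ
      ((fromBlocks P 0 0 (1 : Matrix m m ℝ)).submatrix (Equiv.sumAssoc x k m).symm
        (Equiv.sumAssoc x k m).symm) := by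
  have := (h.pad (m := m)).submatrix (Equiv.sumAssoc x k m).symm
  convert this using 1
  · ext (i | i | i) (j | j | j) <;>
      simp [Acl, SparseH2.padController, mul_fromCols, fromRows_mul]
  · ext (i | i | i) j <;> simp [Bcl, SparseH2.padController, fromRows_mul]
  · ext i (j | j | j) <;> simp [Ccl, SparseH2.padController, mul_fromCols]

/-- Padding by as many states as the plant has makes `Mᵀ` tall enough to be injective, whatever the
order of `J`. -/
theorem lmiFeasible_nonempty {S : Plant x u w z y} {J : Controller k u y} {γ₀ : ℝ}
    (hγ₀ : 0 < γ₀) (h : MeetsH2Spec S γ₀ J) : (lmiFeasible S γ₀).Nonempty := by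
  obtain ⟨hD, P₀, hP₀⟩ := (meetsH2Spec_iff hγ₀).mp h
  have hc := hP₀.padController (m := x)
  set P₁ := (fromBlocks P₀ 0 0 (1 : Matrix x x ℝ)).submatrix (Equiv.sumAssoc x k x).symm
        (Equiv.sumAssoc x k x).symm
  -- `E` couples the plant states with the padding states only. The padded `P₁` vanishes there, so
  -- `Mᵀ` acquires the rows `t I` and is injective for every `t ≠ 0`.
  let E : Matrix (x ⊕ (k ⊕ x)) (x ⊕ (k ⊕ x)) ℝ :=
    fromBlocks 0 (fromCols 0 1) (fromRows 0 1) 0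
  have hE : E.IsHermitian :=
    isHermitian_zero.fromBlocks (by simp [transpose_fromCols])
      isHermitian_zero
  obtain ⟨t, hP, ht⟩ := (((hc.add_smul_eventually hE).filter_mono nhdsWithin_le_nhds).and
    (self_mem_nhdsWithin (s := Set.Ioi (0 : ℝ)))).exists
  have hM : (P₁ + t • E).toBlocks₁₂ᵀ = fromRows P₀.toBlocks₁₂ᵀ (t • 1) := by
    ext (i | i) j <;> simp [P₁, E, toBlocks₁₂, one_apply, eq_comm]
  have hinj : Function.Injective (P₁ + t • E).toBlocks₁₂ᵀ.mulVec := by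
    rw [hM]
    intro a b hab
    funext i
    have := congrFun hab (Sum.inr i)
    simpa [fromRows_mulVec, smul_mulVec, (ne_of_gt ht : t ≠ 0)] using this
  have hl := (isPartition_of_posDef hP.1).lyapunovBlocks hP.1.inv
  rw [nonsing_inv_nonsing_inv _ ((isUnit_iff_isUnit_det _).mp hP.1.isUnit)] at hl
  obtain ⟨Q, hQ⟩ := mem_lmiFeasible_of_certificate hl hinj
    (by simpa [Dcl, padController] using hD) hP
  exact ⟨_, hQ⟩

end Padding

/-! ### Convexity of the programme -/

section Convexity

variable {x u w z y : Type*} [Fintype x] [Fintype u] [Fintype w] [Fintype z] [Fintype y]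
  [DecidableEq x] [DecidableEq w]

theorem smul_fromRows {l m n : Type*} (U : Matrix l n ℝ) (V : Matrix m n ℝ) (c : ℝ) :
    c • fromRows U V = fromRows (c • U) (c • V) := by
  ext (i | i) j <;> rfl

theorem smul_fromCols {l m n : Type*} (U : Matrix n l ℝ) (V : Matrix n m ℝ) (c : ℝ) :
    c • fromCols U V = fromCols (c • U) (c • V) := by
  ext i (j | j) <;> rfl

theorem fromRows_add_fromRows {l m n : Type*} (U U' : Matrix l n ℝ) (V V' : Matrix m n ℝ) :
    fromRows U V + fromRows U' V' = fromRows (U + U') (V + V') := by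
  ext (i | i) j <;> rfl

theorem fromCols_add_fromCols {l m n : Type*} (U U' : Matrix n l ℝ) (V V' : Matrix n m ℝ) :
    fromCols U V + fromCols U' V' = fromCols (U + U') (V + V') := by
  ext i (j | j) <;> rfl

omit [Fintype w] [Fintype z] [DecidableEq x] in
-- The expression is affine and not linear in the variables: `a + b = 1` is what reproduces the
-- constant terms.
theorem lmi₁_combination (S : Plant x u w z y) (J J' : Matrix (x ⊕ u) (x ⊕ y) ℝ)
    (X X' Y Y' : Matrix x x ℝ) {a b : ℝ} (hab : a + b = 1) :
    lmi₁ S (a • J + b • J') (a • X + b • X') (a • Y + b • Y') =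
      a • lmi₁ S J X Y + b • lmi₁ S J' X' Y' := by
  obtain rfl : b = 1 - a := by linarith
  have e11 : (a • J + (1 - a) • J').toBlocks₁₁ = a • J.toBlocks₁₁ + (1 - a) • J'.toBlocks₁₁ := rfl
  have e12 : (a • J + (1 - a) • J').toBlocks₁₂ = a • J.toBlocks₁₂ + (1 - a) • J'.toBlocks₁₂ := rfl
  have e21 : (a • J + (1 - a) • J').toBlocks₂₁ = a • J.toBlocks₂₁ + (1 - a) • J'.toBlocks₂₁ := rfl
  have e22 : (a • J + (1 - a) • J').toBlocks₂₂ = a • J.toBlocks₂₂ + (1 - a) • J'.toBlocks₂₂ := rfl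
  simp only [lmi₁, e11, e12, e21, e22, fromBlocks_smul, fromBlocks_add, sym]
  rw [smul_fromRows, smul_fromRows, smul_fromCols, smul_fromCols, fromRows_add_fromRows,
    fromCols_add_fromCols]
  simp only [Matrix.mul_add, Matrix.add_mul, Matrix.mul_smul, Matrix.smul_mul, transpose_add,
    transpose_smul, smul_add]
  congr 1
  · congr 1 <;> module
  · congr 1 <;> module
  · congr 1 <;> module
  · module

omit [Fintype w] [Fintype z] [DecidableEq w] in
theorem lmi₂_combination (S : Plant x u w z y) (J J' : Matrix (x ⊕ u) (x ⊕ y) ℝ)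
    (X X' Y Y' : Matrix x x ℝ) (Q Q' : Matrix z z ℝ) {a b : ℝ} (hab : a + b = 1) :
    lmi₂ S (a • J + b • J') (a • X + b • X') (a • Y + b • Y') (a • Q + b • Q') =
      a • lmi₂ S J X Y Q + b • lmi₂ S J' X' Y' Q' := by
  obtain rfl : b = 1 - a := by linarith
  have e21 : (a • J + (1 - a) • J').toBlocks₂₁ = a • J.toBlocks₂₁ + (1 - a) • J'.toBlocks₂₁ := rfl
  have e22 : (a • J + (1 - a) • J').toBlocks₂₂ = a • J.toBlocks₂₂ + (1 - a) • J'.toBlocks₂₂ := rfl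
  simp only [lmi₂, e21, e22, fromBlocks_smul, fromBlocks_add]
  rw [smul_fromRows, smul_fromRows, smul_fromCols, smul_fromCols, fromRows_add_fromRows,
    fromCols_add_fromCols]
  simp only [Matrix.mul_add, Matrix.add_mul, Matrix.mul_smul, Matrix.smul_mul, transpose_add,
    transpose_smul, smul_add]
  congr 1
  · congr 1 <;> module
  · congr 1 <;> module
  · congr 1 <;> module

theorem posDef_combination {n : Type*} {A B : Matrix n n ℝ} (hA : A.PosDef) (hB : B.PosDef)
    {a b : ℝ} (ha : 0 ≤ a) (hb : 0 ≤ b) (hab : a + b = 1) : (a • A + b • B).PosDef := by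
  rcases ha.eq_or_lt with rfl | ha
  · obtain rfl : b = 1 := by linarith
    simpa using hB
  · exact (hA.smul ha).add_posSemidef (hB.posSemidef.smul hb)

omit [Fintype w] in
theorem convex_lmiFeasible (S : Plant x u w z y) (γ₀ : ℝ) : Convex ℝ (lmiFeasible S γ₀) := by
  rintro ⟨J, X, Y, Q⟩ ⟨h1, h2, h3, h4⟩ ⟨J', X', Y', Q'⟩ ⟨h1', h2', h3', h4'⟩ a b ha hb hab
  refine ⟨?_, ?_, ?_, ?_⟩
  · change (-(lmi₁ S (a • J + b • J') (a • X + b • X') (a • Y + b • Y'))).PosDef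
    rw [lmi₁_combination S J J' X X' Y Y' hab, neg_add, ← smul_neg, ← smul_neg]
    exact posDef_combination h1 h1' ha hb hab
  · change (lmi₂ S (a • J + b • J') (a • X + b • X') (a • Y + b • Y') (a • Q + b • Q')).PosDef
    rw [lmi₂_combination S J J' X X' Y Y' Q Q' hab]
    exact posDef_combination h2 h2' ha hb hab
  · change (a • Q + b • Q').trace < _
    change Q.trace < _ at h3
    change Q'.trace < _ at h3'
    rw [trace_add, trace_smul, trace_smul]
    exact convex_Iio (𝕜 := ℝ) (γ₀ ^ 2) h3 h3' ha hb hab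
  · change S.Dw + S.Du * (a • J.toBlocks₂₂ + b • J'.toBlocks₂₂) * S.Dyw = 0
    calc _ = a • (S.Dw + S.Du * J.toBlocks₂₂ * S.Dyw) +
          b • (S.Dw + S.Du * J'.toBlocks₂₂ * S.Dyw) := by
          obtain rfl : b = 1 - a := by linarith
          simp only [Matrix.mul_add, Matrix.add_mul, Matrix.mul_smul, Matrix.smul_mul]
          module
      _ = 0 := by
          rw [show S.Dw + S.Du * J.toBlocks₂₂ * S.Dyw = 0 from h4,
            show S.Dw + S.Du * J'.toBlocks₂₂ * S.Dyw = 0 from h4', smul_zero, smul_zero, add_zero]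

theorem norm_toLp_combination_le {ι : Type*} [Fintype ι] (f g : ι → ℝ) {a b : ℝ} (ha : 0 ≤ a)
    (hb : 0 ≤ b) : ‖WithLp.toLp 2 (a • f + b • g)‖ ≤
      a * ‖WithLp.toLp 2 f‖ + b * ‖WithLp.toLp 2 g‖ := by
  rw [WithLp.toLp_add, WithLp.toLp_smul, WithLp.toLp_smul]
  refine (norm_add_le _ _).trans ?_
  rw [norm_smul, norm_smul, Real.norm_of_nonneg ha, Real.norm_of_nonneg hb]

omit [DecidableEq x] in
theorem cost_combination_le {μ : u → ℝ} {ν : y → ℝ} (hμ : ∀ i, 0 ≤ μ i) (hν : ∀ j, 0 ≤ ν j)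
    (J J' : Matrix (x ⊕ u) (x ⊕ y) ℝ) {a b : ℝ} (ha : 0 ≤ a) (hb : 0 ≤ b) :
    cost μ ν (a • J + b • J') ≤ a * cost μ ν J + b * cost μ ν J' := by
  have h1 : ∀ i, (fun c => fromCols (a • J + b • J').toBlocks₂₁ (a • J + b • J').toBlocks₂₂ i c) =
      a • (fun c => fromCols J.toBlocks₂₁ J.toBlocks₂₂ i c) +
      b • (fun c => fromCols J'.toBlocks₂₁ J'.toBlocks₂₂ i c) := fun i => by
    ext (c | c) <;> rfl
  have h2 : ∀ j, (fun r => fromRows (a • J + b • J').toBlocks₁₂ (a • J + b • J').toBlocks₂₂ r j) =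
      a • (fun r => fromRows J.toBlocks₁₂ J.toBlocks₂₂ r j) +
      b • (fun r => fromRows J'.toBlocks₁₂ J'.toBlocks₂₂ r j) := fun j => by
    ext (r | r) <;> rfl
  simp only [cost, h1, h2, mul_add, Finset.mul_sum]
  rw [add_add_add_comm, ← Finset.sum_add_distrib, ← Finset.sum_add_distrib]
  refine add_le_add (Finset.sum_le_sum fun i _ => ?_) (Finset.sum_le_sum fun j _ => ?_)
  · refine (mul_le_mul_of_nonneg_left (norm_toLp_combination_le _ _ ha hb) (hμ i)).trans
      (le_of_eq ?_)
    ring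
  · refine (mul_le_mul_of_nonneg_left (norm_toLp_combination_le _ _ ha hb) (hν j)).trans
      (le_of_eq ?_)
    ring

end Convexity

end SparseH2

end

/-! ### Assembly of the theorem -/

theorem theorem5 {nx nu nw nz ny : ℕ}
    (S : SparseH2.Plant (Fin nx) (Fin nu) (Fin nw) (Fin nz) (Fin ny))
    (γ₀ : ℝ) (hγ₀ : 0 < γ₀)
    (μ : Fin nu → ℝ) (ν : Fin ny → ℝ) (hμ : ∀ i, 0 ≤ μ i) (hν : ∀ j, 0 ≤ ν j) :
    -- the two problems have the same feasible `Ĵ` ...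
    SparseH2.designFeasible S γ₀ = Prod.fst '' SparseH2.lmiFeasible S γ₀ ∧
    -- ... the same optimal value ...
    (⨅ Jh ∈ SparseH2.designFeasible S γ₀, ((SparseH2.cost μ ν Jh : ℝ) : EReal)) =
      (⨅ p ∈ SparseH2.lmiFeasible S γ₀, ((SparseH2.cost μ ν p.1 : ℝ) : EReal)) ∧
    -- ... and the same solutions
    (∀ Jh, (Jh ∈ SparseH2.designFeasible S γ₀ ∧
          IsMinOn (SparseH2.cost μ ν) (SparseH2.designFeasible S γ₀) Jh) ↔
        ∃ X Y Q, (Jh, X, Y, Q) ∈ SparseH2.lmiFeasible S γ₀ ∧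
          IsMinOn (fun p => SparseH2.cost μ ν p.1) (SparseH2.lmiFeasible S γ₀) (Jh, X, Y, Q)) ∧
    -- a full-order controller meets the closed-loop specification iff the matrix inequalities
    -- hold for its transformed variables with respect to some partitioned Lyapunov matrix
    (∀ J : SparseH2.Controller (Fin nx) (Fin nu) (Fin ny), SparseH2.MeetsH2Spec S γ₀ J ↔
        ∃ Xcl X Y M N Q, Xcl.PosDef ∧ SparseH2.IsPartition Xcl X Y M N ∧ IsUnit M ∧ IsUnit N ∧
          (SparseH2.hat S J X Y M N, X, Y, Q) ∈ SparseH2.lmiFeasible S γ₀) ∧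
    -- every feasible point of the matrix inequalities yields, by the explicit construction, a
    -- controller that meets the specification and has the given transformed variables
    (∀ Jh X Y Q, (Jh, X, Y, Q) ∈ SparseH2.lmiFeasible S γ₀ →
        IsUnit (1 - X * Y) ∧
        ∀ M N, M * Nᵀ = 1 - X * Y →
          SparseH2.Represents S γ₀ (SparseH2.construct S Jh X Y M N) X Y M N Jh) ∧
    -- controllers of other orders do not help: if one meets the specification, the matrix
    -- inequalities are feasible
    (∀ (k : ℕ) (J : SparseH2.Controller (Fin k) (Fin nu) (Fin ny)),
        SparseH2.MeetsH2Spec S γ₀ J → (SparseH2.lmiFeasible S γ₀).Nonempty) ∧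
    -- the programme with matrix inequalities is convex
    ConvexOn ℝ (SparseH2.lmiFeasible S γ₀) (fun p => SparseH2.cost μ ν p.1) := by
  have hset := SparseH2.designFeasible_eq (S := S) hγ₀
  refine ⟨hset, ?_, fun Jh => ?_, SparseH2.meetsH2Spec_iff_exists_mem_lmiFeasible hγ₀,
    fun Jh X Y Q h => ⟨SparseH2.isUnit_one_sub_mul (SparseH2.posDef_of_mem_lmiFeasible h),
      fun M N hMN => SparseH2.represents_construct hγ₀ h hMN⟩,
    fun k J h => SparseH2.lmiFeasible_nonempty hγ₀ h,
    SparseH2.convex_lmiFeasible S γ₀, fun p _ q _ a b ha hb _ =>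
      SparseH2.cost_combination_le hμ hν p.1 q.1 ha hb⟩
  -- The cost factors through `Prod.fst`, so its infimum over the projection is its infimum over the
  -- feasible set itself.
  · rw [hset, iInf_image]
  · rw [hset]
    constructor
    · rintro ⟨⟨⟨Jh, X, Y, Q⟩, h, rfl⟩, hmin⟩
      exact ⟨X, Y, Q, h, fun p hp => hmin ⟨p, hp, rfl⟩⟩
    · rintro ⟨X, Y, Q, h, hmin⟩
      refine ⟨⟨_, h, rfl⟩, ?_⟩
      rintro _ ⟨p, hp, rfl⟩
      exact hmin hp
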